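/- Let $\mathcal O(1)\to\mathbb P^1$ be the hyperplane bundle. A continuous Hermitian metric $\Phi$ on it is identified with its weight $\Phi(z)$ on the affine piece $\mathbb C\subset\mathbb P^1$ (so that $\Phi(1/w)+\log|w|^2$ extends continuously to $w=0$). Its curvature is the current on $\mathbb P^1$ given by $\omega_\Phi=\frac{i}{2\pi}\partial\bar\partial\Phi$ on $\mathbb C$ (and by the same formula for the weight $\Phi(1/w)+\log|w|^2$ in the chart $w=1/z$). Let $\Phi_0(z)=\log(1+|z|^2)$ be the Fubini–Study metric and $\omega_0=\omega_{\Phi_0}$. Let $\mathcal H_{1,1}$ be the set of metrics $\Phi$ for which $\omega_\Phi$ is a semi-positive $L^\infty$-form. For $\Phi\in\mathcal H_{1,1}$ the K-energy is given by the Chen–Tian formula $$\mathcal M(\Phi)=\frac{\bar R}{2}\,\mathcal E(\Phi)-\mathcal E^{\mathrm{Ric}\,\omega_0}(\Phi)+\int_{\mathbb P^1}\log\Big(\frac{\omega_\Phi}{\omega_0}\Big)\,\omega_\Phi,\qquad \bar R=\frac{\int_{\mathbb P^1}\mathrm{Ric}\,\omega_0}{\int_{\mathbb P^1}\omega_0},$$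 where $\mathrm{Ric}\,\omega_0=-\frac{i}{2\pi}\partial\bar\partial\log\omega_0$ represents $c_1(\mathbb P^1)$, and $\mathcal E$, $\mathcal E^{\mathrm{Ric}\,\omega_0}$ are the functionals with differentials $d\mathcal E_{|\Phi}=2\omega_\Phi$ and $d\mathcal E^{\mathrm{Ric}\,\omega_0}_{|\Phi}=\mathrm{Ric}\,\omega_0$, normalized by $\mathcal E(\Phi_0)=\mathcal E^{\mathrm{Ric}\,\omega_0}(\Phi_0)=0$ (so that $\mathcal M(\Phi_0)=0$). Let $\Phi\in\mathcal H_{1,1}$ be invariant under the standard action of $S^1$ on $\mathbb P^1$, write $\phi(x)=\Phi(z)$ with $x=\log|z|^2\in\mathbb R$, and let $u(y)=\sup_{x\in\mathbb R}(xy-\phi(x))$, $y\in[0,1]$, be its Legendre transform. Then the entropy integral above converges absolutely, $u$ is finite and integrable on $[0,1]$, its second distributional derivative $\partial^2u$ on $]0,1[$ is a locally finite measure, the density $u''$ of the absolutely continuous part of $\partial^2 u$ satisfies $u''>0$ almost everywhere on $[0,1]$, $\log u''$ is integrable on $[0,1]$, and $$\mathcal M(\Phi)=2\Big(\tfrac12\big(u(0)+u(1)\big)-\int_0^1u(y)\,dy\Big)-\int_0^1\log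 u''(y)\,dy+1.$$ -/

import Mathlib

open MeasureTheory Set
open scoped ContDiff

noncomputable section

/-! ### Metrics on `O(1)` over the Riemann sphere

The sphere is glued from two copies of `ℂ` with coordinates `z` and `w = 1/z`. -/

/-- A (continuous) Hermitian metric on the hyperplane bundle `O(1) → ℙ¹`, given by its weights in
the standard trivializations over the charts `z` and `w = 1/z`: a section with coefficients
`s₀`, `s∞ = w s₀` has squared length `|s₀|² exp(-weight₀)`, resp. `|s∞|² exp(-weightInf)`. -/
structure O1Metric where
  /-- The weight `Φ(z)` on the affine piece `ℂ`. -/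
  weight : ℂ → ℝ
  /-- The weight in the chart `w = 1/z` around the point at infinity. -/
  weightInf : ℂ → ℝ
  continuous_weight : Continuous weight
  continuous_weightInf : Continuous weightInf
  compat : ∀ w : ℂ, w ≠ 0 → weightInf w = weight w⁻¹ + Real.log (‖w‖ ^ 2)

namespace O1Metric

/-- The Fubini–Study metric `Φ₀(z) = log (1 + |z|²)`. -/
def fs : O1Metric where
  weight z := Real.log (1 + ‖z‖ ^ 2)
  weightInf w := Real.log (1 + ‖w‖ ^ 2)
  continuous_weight := by
    refine Continuous.log (by fun_prop) (fun z => ?_)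
    positivity
  continuous_weightInf := by
    refine Continuous.log (by fun_prop) (fun z => ?_)
    positivity
  compat w hw := by
    have h : 0 < ‖w‖ := norm_pos_iff.mpr hw
    rw [← Real.log_mul (by positivity) (by positivity), norm_inv]
    congr 1
    field_simp
    ring

/-- The metric `(1 - t) Φ + t Ψ` on the segment from `Φ` to `Ψ`. -/
def segment (Φ Ψ : O1Metric) (t : ℝ) : O1Metric where
  weight z := (1 - t) * Φ.weight z + t * Ψ.weight z
  weightInf w := (1 - t) * Φ.weightInf w + t * Ψ.weightInf w
  continuous_weight := by
    have := Φ.continuous_weight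
    have := Ψ.continuous_weight
    fun_prop
  continuous_weightInf := by
    have := Φ.continuous_weightInf
    have := Ψ.continuous_weightInf
    fun_prop
  compat w hw := by
    rw [Φ.compat w hw, Ψ.compat w hw]
    ring

/-- Density, with respect to Lebesgue measure on `ℂ`, of the real `(1,1)`-form
`(i/2π) ∂∂̄ f = (1/4π) Δf dA`, for a smooth function `f`. -/
def ddcDensity (f : ℂ → ℝ) (z : ℂ) : ℝ :=
  (4 * Real.pi)⁻¹ * Laplacian.laplacian f z

/-- Density of the Fubini–Study form `ω₀ = (i/2π) ∂∂̄ Φ₀`. -/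
def fsDensity : ℂ → ℝ := ddcDensity fs.weight

/-- Density of `Ric ω₀ = -(i/2π) ∂∂̄ log ω₀`, which represents `c₁(ℙ¹)`. -/
def ricDensity (z : ℂ) : ℝ := -ddcDensity (fun z => Real.log (fsDensity z)) z

/-- The constant `R̄ = n c₁(X)·[ω₀]ⁿ⁻¹ / [ω₀]ⁿ` for `X = ℙ¹`, `n = 1`. -/
def meanRic : ℝ := (∫ z, ricDensity z) / (∫ z, fsDensity z)

/-- The curvature current `ω_Φ = (i/2π) ∂∂̄ Φ` of `Φ` on `ℙ¹` is the semi-positive `L^∞`-form with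
density `h` with respect to Lebesgue measure on the chart `z`: bounded relative to `ω₀`, and equal
to the curvature current when tested against smooth functions supported in either chart. In the
chart `w = 1/z` the same form has density `h(1/w) / |w|⁴`. -/
structure IsCurvatureDensity (Φ : O1Metric) (h : ℂ → ℝ) : Prop where
  measurable : Measurable h
  nonneg : ∀ᵐ z : ℂ, 0 ≤ h z
  bounded : ∃ C : ℝ, ∀ᵐ z : ℂ, h z ≤ C * fsDensity z
  weak : ∀ χ : ℂ → ℝ, ContDiff ℝ ∞ χ → HasCompactSupport χ →
    ∫ z, Φ.weight z * ddcDensity χ z = ∫ z, χ z * h z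
  weakInf : ∀ χ : ℂ → ℝ, ContDiff ℝ ∞ χ → HasCompactSupport χ →
    ∫ w, Φ.weightInf w * ddcDensity χ w = ∫ w, χ w * (h w⁻¹ / ‖w‖ ^ 4)

/-- `Φ ∈ H_{1,1}`: the curvature of `Φ` is a semi-positive `L^∞`-form. -/
def MemH11 (Φ : O1Metric) : Prop := ∃ h, IsCurvatureDensity Φ h

/-- Invariance under the standard action of the circle by rotations of `z`. -/
def IsS1Invariant (Φ : O1Metric) : Prop :=
  ∀ (c : Circle) (z : ℂ), Φ.weight (c * z) = Φ.weight z

open Classical in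
/-- The density of the curvature form `ω_Φ` for `Φ ∈ H_{1,1}` (unique almost everywhere);
by convention `0` otherwise. -/
def curvature (Φ : O1Metric) : ℂ → ℝ :=
  if h : MemH11 Φ then h.choose else 0

/-! ### The K-energy, by the Chen–Tian formula with `n = 1` -/

/-- The primitive, normalized to vanish at `Φ₀`, of a one-form `α` on the space of metrics
(`α Φ f` is the value at `Φ` on the tangent vector `f`), by integration along the segment
from `Φ₀` to `Φ`. -/
def primitive (α : O1Metric → (ℂ → ℝ) → ℝ) (Φ : O1Metric) : ℝ :=
  ∫ t in (0 : ℝ)..1, α (segment fs Φ t) (fun z => Φ.weight z - fs.weight z)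

/-- The functional `E` with `dE|_Φ = (n + 1) ω_Φⁿ = 2 ω_Φ` and `E(Φ₀) = 0`. -/
def energy : O1Metric → ℝ :=
  primitive (fun Φ f => ∫ z, f z * (2 * curvature Φ z))

/-- The functional `E^{Ric ω₀}` with `dE^{Ric ω₀}|_Φ = n ω_Φⁿ⁻¹ ∧ Ric ω₀ = Ric ω₀`, vanishing
at `Φ₀`. -/
def ricEnergy : O1Metric → ℝ :=
  primitive (fun _ f => ∫ z, f z * ricDensity z)

/-- The integrand of the entropy `∫ log (ω_Φ / ω₀) ω_Φ` (with `0 log 0 = 0`). -/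
def entropyIntegrand (Φ : O1Metric) (z : ℂ) : ℝ :=
  Real.log (curvature Φ z / fsDensity z) * curvature Φ z

/-- The K-energy
`M(Φ) = (R̄ / (n + 1)) E(Φ) - E^{Ric ω₀}(Φ) + ∫ log (ω_Φ / ω₀) ω_Φ`, so that `M(Φ₀) = 0`. -/
def kEnergy (Φ : O1Metric) : ℝ :=
  (meanRic / 2 * energy Φ - ricEnergy Φ) + ∫ z, entropyIntegrand Φ z

/-! ### The Legendre transform -/

/-- The function `φ(x) = Φ(z)` of the logarithmic coordinate `x = log |z|²`. -/
def logWeight (Φ : O1Metric) (x : ℝ) : ℝ := Φ.weight (Real.exp (x / 2) : ℝ)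

end O1Metric

/-- The Legendre transform `u(y) = sup_x (x y - φ(x))`. -/
def legendre (φ : ℝ → ℝ) (y : ℝ) : ℝ := ⨆ x : ℝ, (x * y - φ x)

/-- The measure `ν` is the second distributional derivative of `u` on the open interval `(0,1)`:
it lives on `(0,1)`, is finite on compact subsets of it, and `∫ u χ'' = ∫ χ dν` for all smooth
`χ` with compact support in `(0,1)`. -/
structure IsDistribSecondDeriv (u : ℝ → ℝ) (ν : Measure ℝ) : Prop where
  outside : ν (Ioo 0 1)ᶜ = 0
  finite : ∀ K : Set ℝ, IsCompact K → K ⊆ Ioo 0 1 → ν K < ⊤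
  weak : ∀ χ : ℝ → ℝ, ContDiff ℝ ∞ χ → HasCompactSupport χ → tsupport χ ⊆ Ioo 0 1 →
    ∫ y, u y * deriv (deriv χ) y = ∫ y, χ y ∂ν

open Classical in
/-- The second distributional derivative `∂²u` of `u` on `(0,1)`, when it is a measure
(as for convex `u`; it is then unique); by convention `0` otherwise. -/
def distribSecondDeriv (u : ℝ → ℝ) : Measure ℝ :=
  if h : ∃ ν, IsDistribSecondDeriv u ν then h.choose else 0

/-- The function `u''`: the density of the absolutely continuous part, in the Lebesgue
decomposition with respect to Lebesgue measure, of the measure `∂²u`. -/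
def regSecondDeriv (u : ℝ → ℝ) (y : ℝ) : ℝ :=
  ((distribSecondDeriv u).rnDeriv volume y).toReal

end

/-! In the coordinate x = log |z|², a circle-invariant Φ becomes a function φ on ℝ and its curvature
becomes H(x) dx, with φ'' = H as distributions and 0 ≤ H ≤ C · `fsLogDensity`. Hence φ is C¹ and
convex, and φ' = F, the primitive of H vanishing at -∞ (`hasDerivAt_of_weak`). Continuity of the two
weights at the poles gives φ → b at -∞ and φ - x → a at +∞, so F rises from 0 to 1. This F is the
moment map: it carries H dx to Lebesgue measure on (0,1) (`map_moment`), which turns integrals in y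
into integrals in x.

Write φ₀ for `fsPotential`. Since Ric ω₀ = 2ω₀ and R̄ = 2, the energy part of the K-energy is ∫ (Φ -
Φ₀)(ω - ω₀) (`kEnergy_eq`), while the entropy is ∫ H log H - ∫ (x - 2φ₀) H. Convexity gives u(F(x))
= x F(x) - φ(x) (`legendre_moment`), so ∫ u dy = ∫ (xF - φ) H dx, and u(0) = -b, u(1) = -a. Apart
from ∫ H log H, everything combines through one explicit primitive, with limits b and 1 - a at the
two ends (`integral_energy`).

It remains to see that ∫ log u'' dy = -∫ H log H dx. Formally u''(F(x)) = 1/H(x), but H may vanish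
and F need not be injective. The measure ∂²u is the push-forward under F of Lebesgue measure on {0 <
F < 1} (`isDistribSecondDeriv_legendre`). Over almost every level F is injective and H is positive,
and there the push-forward has density 1/H in terms of y; what lies over the other levels is
singular (`ae_rnDeriv_momentPushforward`). -/

/-! ### Polar integration in the logarithmic coordinate. -/

/-- Integrals of radial functions on `ℂ` in the coordinate `x = log |z|²`. -/
theorem integral_radial (k : ℝ → ℝ) :
    ∫ z : ℂ, k ‖z‖ = ∫ x : ℝ, Real.pi * Real.exp x * k (Real.exp (x / 2)) := by
  have h1 := integral_fun_norm_addHaar (volume : Measure ℂ) k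
  have hb : (volume : Measure ℂ).real (Metric.ball 0 1) = Real.pi := by
    simp [Measure.real, Complex.volume_ball]
  rw [h1, hb, Complex.finrank_real_complex]
  have h2 := integral_image_eq_integral_abs_deriv_smul (s := univ) (f := fun x => Real.exp (x / 2))
    (f' := fun x => Real.exp (x / 2) * (1 / 2)) MeasurableSet.univ
    (fun x _ => (((hasDerivAt_id x).div_const 2).exp).hasDerivWithinAt)
    (fun x _ y _ h => by simpa using h) (fun y => y ^ (2 - 1) • k y)
  have himg : (fun x : ℝ => Real.exp (x / 2)) '' univ = Ioi 0 := by
    ext y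
    simp only [image_univ, mem_range, mem_Ioi]
    constructor
    · rintro ⟨x, rfl⟩
      positivity
    · intro hy
      exact ⟨2 * Real.log y, by rw [mul_div_cancel_left₀ _ two_ne_zero, Real.exp_log hy]⟩
  rw [himg] at h2
  rw [h2, setIntegral_univ, nsmul_eq_mul, smul_eq_mul, ← integral_const_mul, ← integral_const_mul]
  congr 1
  ext x
  have : Real.exp x = Real.exp (x / 2) * Real.exp (x / 2) := by
    rw [← Real.exp_add]; congr 1; ring
  rw [this, abs_of_pos (by positivity)]
  simp only [smul_eq_mul]
  push_cast
  ring

theorem integrable_radial (k : ℝ → ℝ) :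
    Integrable (fun z : ℂ => k ‖z‖) ↔
      Integrable (fun x : ℝ => Real.pi * Real.exp x * k (Real.exp (x / 2))) := by
  rw [integrable_fun_norm_addHaar, Complex.finrank_real_complex]
  have h2 := integrableOn_image_iff_integrableOn_abs_deriv_smul (s := univ)
    (f := fun x => Real.exp (x / 2))
    (f' := fun x => Real.exp (x / 2) * (1 / 2)) MeasurableSet.univ
    (fun x _ => (((hasDerivAt_id x).div_const 2).exp).hasDerivWithinAt)
    (fun x _ y _ h => by simpa using h) (fun y => y ^ (2 - 1) • k y)
  have himg : (fun x : ℝ => Real.exp (x / 2)) '' univ = Ioi 0 := by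
    ext y
    simp only [image_univ, mem_range, mem_Ioi]
    constructor
    · rintro ⟨x, rfl⟩
      positivity
    · intro hy
      exact ⟨2 * Real.log y, by rw [mul_div_cancel_left₀ _ two_ne_zero, Real.exp_log hy]⟩
  rw [himg] at h2
  rw [h2, integrableOn_univ, ← integrable_const_mul_iff (c := 2 * Real.pi)
    (by simp [Real.pi_ne_zero])]
  congr! 2 with x
  have : Real.exp x = Real.exp (x / 2) * Real.exp (x / 2) := by
    rw [← Real.exp_add]; congr 1; ring
  rw [this, abs_of_pos (by positivity)]
  simp only [smul_eq_mul]
  ring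

/-! ### The Laplacian on the plane: radial functions, rotations, Green's formula. -/

section Laplacian

theorem laplacian_eq_fderiv {f : ℂ → ℝ} (hf : ContDiff ℝ 2 f) (z : ℂ) :
    Laplacian.laplacian f z = fderiv ℝ (fun w => fderiv ℝ f w 1) z 1
      + fderiv ℝ (fun w => fderiv ℝ f w Complex.I) z Complex.I := by
  have hd : DifferentiableAt ℝ (fderiv ℝ f) z :=
    ((hf.fderiv_right (m := 1) (by norm_num)).differentiable one_ne_zero) z
  rw [InnerProductSpace.laplacian_eq_iteratedFDeriv_complexPlane]
  simp only [iteratedFDeriv_two_apply, Matrix.cons_val_zero, Matrix.cons_val_one]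
  rw [fderiv_clm_apply hd (by fun_prop), fderiv_clm_apply hd (by fun_prop)]
  simp

theorem hasFDerivAt_norm_sq_complex (z : ℂ) :
    HasFDerivAt (fun w : ℂ => ‖w‖ ^ 2) (2 • (innerSL ℝ z)) z := by
  simpa using (hasStrictFDerivAt_norm_sq z).hasFDerivAt

/-- The Laplacian of `k(|z|²)`. -/
theorem laplacian_comp_norm_sq {k k' k'' : ℝ → ℝ} (hk : ContDiff ℝ 2 fun z : ℂ => k (‖z‖ ^ 2))
    (h1 : ∀ s, 0 ≤ s → HasDerivAt k (k' s) s) (h2 : ∀ s, 0 ≤ s → HasDerivAt k' (k'' s) s) (z : ℂ) :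
    Laplacian.laplacian (fun z : ℂ => k (‖z‖ ^ 2)) z =
      4 * k' (‖z‖ ^ 2) + 4 * ‖z‖ ^ 2 * k'' (‖z‖ ^ 2) := by
  rw [laplacian_eq_fderiv hk]
  have hA : ∀ v w : ℂ, fderiv ℝ (fun z : ℂ => k (‖z‖ ^ 2)) w v
      = k' (‖w‖ ^ 2) * (2 * inner ℝ w v) := by
    intro v w
    have d : HasFDerivAt (fun z : ℂ => k (‖z‖ ^ 2)) _ w :=
      (h1 _ (by positivity)).comp_hasFDerivAt w (hasFDerivAt_norm_sq_complex w)
    rw [d.fderiv]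
    simp only [smul_apply, innerSL_apply_apply, smul_eq_mul, nsmul_eq_mul, Nat.cast_ofNat]
  have hB : ∀ v w : ℂ, fderiv ℝ (fun w => fderiv ℝ (fun z : ℂ => k (‖z‖ ^ 2)) w v) w v
      = k'' (‖w‖ ^ 2) * (2 * inner ℝ w v) ^ 2 + k' (‖w‖ ^ 2) * (2 * inner ℝ v v) := by
    intro v w
    have e : (fun w => fderiv ℝ (fun z : ℂ => k (‖z‖ ^ 2)) w v)
      = fun w => k' (‖w‖ ^ 2) * (2 * innerSL ℝ v w) := by
      ext w; rw [hA]; simp [real_inner_comm]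
    rw [e]
    have d1 : HasFDerivAt (fun z : ℂ => k' (‖z‖ ^ 2)) _ w :=
      (h2 _ (by positivity)).comp_hasFDerivAt w (hasFDerivAt_norm_sq_complex w)
    have d2 : HasFDerivAt (fun w => 2 * innerSL ℝ v w) ((2 : ℝ) • innerSL ℝ v) w :=
      (innerSL ℝ v).hasFDerivAt.const_mul 2
    have d3 : HasFDerivAt (fun w => k' (‖w‖ ^ 2) * (2 * innerSL ℝ v w)) _ w := d1.mul d2
    rw [d3.fderiv]
    simp only [add_apply, smul_apply, innerSL_apply_apply,
      smul_eq_mul, nsmul_eq_mul, real_inner_comm w v]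
    push_cast
    ring
  rw [hB, hB]
  have hz : ‖z‖ ^ 2 = z.re ^ 2 + z.im ^ 2 := by
    rw [Complex.sq_norm, Complex.normSq_apply]; ring
  have e1 : inner ℝ z 1 = z.re := by simp [Complex.inner]
  have e2 : inner ℝ z Complex.I = z.im := by simp [Complex.inner]
  rw [e1, e2, real_inner_self_eq_norm_sq, real_inner_self_eq_norm_sq]
  simp only [norm_one, Complex.norm_I]
  linear_combination -4 * k'' (‖z‖ ^ 2) * hz

/-- The Laplacian may be computed in any orthonormal basis. The standard basis on the left
corresponds to its rotated image on the right. -/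
theorem laplacian_comp_rotation {f : ℂ → ℝ} (hf : ContDiff ℝ 2 f) (c : Circle) (z : ℂ) :
    Laplacian.laplacian (fun w => f (c * w)) z = Laplacian.laplacian f (c * z) := by
  have hc : (fun w : ℂ => f (c * w)) = f ∘ (rotation c).toContinuousLinearEquiv.toContinuousLinearMap := by
    ext w; simp [rotation_apply]
  rw [InnerProductSpace.laplacian_eq_iteratedFDeriv_orthonormalBasis _ Complex.orthonormalBasisOneI,
    InnerProductSpace.laplacian_eq_iteratedFDeriv_orthonormalBasis f
      (Complex.orthonormalBasisOneI.map (rotation c)), hc]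
  refine Finset.sum_congr rfl fun i _ => ?_
  rw [ContinuousLinearMap.iteratedFDeriv_comp_right _ hf _ le_rfl]
  simp only [ContinuousMultilinearMap.compContinuousLinearMap_apply]
  congr 1
  ext j
  fin_cases j <;> simp

theorem ddcDensity_continuous {χ : ℂ → ℝ} (hχ : ContDiff ℝ 2 χ) :
    Continuous (O1Metric.ddcDensity χ) := by
  unfold O1Metric.ddcDensity
  rw [InnerProductSpace.laplacian_eq_iteratedFDeriv_complexPlane]
  have := hχ.continuous_iteratedFDeriv (m := 2) le_rfl
  refine continuous_const.mul (.add ?_ ?_)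
  · exact (ContinuousMultilinearMap.apply ℝ (fun _ : Fin 2 => ℂ) ℝ ![1, 1]).continuous.comp this
  · exact (ContinuousMultilinearMap.apply ℝ (fun _ : Fin 2 => ℂ) ℝ
      ![Complex.I, Complex.I]).continuous.comp this

theorem ddcDensity_hasCompactSupport {χ : ℂ → ℝ} (hχ : HasCompactSupport χ) :
    HasCompactSupport (O1Metric.ddcDensity χ) := by
  unfold O1Metric.ddcDensity
  rw [InnerProductSpace.laplacian_eq_iteratedFDeriv_complexPlane]
  have := hχ.iteratedFDeriv (𝕜 := ℝ) 2
  refine this.mono ?_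
  intro z hz hz'
  apply hz
  simp [hz']

/-- Green's formula: two integrations by parts in each of the directions 1 and i. Only χ needs
compact support, since it cuts off every product that occurs. -/
theorem integral_mul_ddcDensity {f χ : ℂ → ℝ} (hf : ContDiff ℝ ∞ f) (hχ : ContDiff ℝ ∞ χ)
    (hc : HasCompactSupport χ) :
    ∫ z, f z * O1Metric.ddcDensity χ z = ∫ z, χ z * O1Metric.ddcDensity f z := by
  have hdir : ∀ v : ℂ, ∀ g : ℂ → ℝ, ContDiff ℝ ∞ g → ContDiff ℝ ∞ (fun w => fderiv ℝ g w v) :=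
    fun v g hg => (hg.fderiv_right (m := ∞) (by norm_num)).clm_apply contDiff_const
  have hdc : ∀ v : ℂ, ∀ g : ℂ → ℝ, HasCompactSupport g →
      HasCompactSupport (fun w => fderiv ℝ g w v) := fun v g hg => hg.fderiv_apply (𝕜 := ℝ) v
  have one : ∀ v : ℂ, ∀ f g : ℂ → ℝ, ContDiff ℝ ∞ f → ContDiff ℝ ∞ g → HasCompactSupport g →
      ∫ z, f z * fderiv ℝ g z v = - ∫ z, fderiv ℝ f z v * g z := by
    intro v f g hf hg hgc
    refine integral_mul_fderiv_eq_neg_fderiv_mul_of_integrable ?_ ?_ ?_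
      (fun x _ => hf.differentiable (by simp) x) (fun x _ => hg.differentiable (by simp) x)
    · exact ((hdir v f hf).continuous.mul hg.continuous).integrable_of_hasCompactSupport
        hgc.mul_left
    · exact (hf.continuous.mul (hdir v g hg).continuous).integrable_of_hasCompactSupport
        (hdc v g hgc).mul_left
    · exact (hf.continuous.mul hg.continuous).integrable_of_hasCompactSupport hgc.mul_left
  have two : ∀ v : ℂ, ∫ z, f z * fderiv ℝ (fun w => fderiv ℝ χ w v) z v
      = ∫ z, χ z * fderiv ℝ (fun w => fderiv ℝ f w v) z v := by
    intro v
    rw [one v f _ hf (hdir v χ hχ) (hdc v χ hc), one v _ χ (hdir v f hf) hχ hc, neg_neg]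
    simp only [mul_comm]
  have i1 : ∀ v : ℂ, Integrable (fun z => f z * fderiv ℝ (fun w => fderiv ℝ χ w v) z v) :=
    fun v => (hf.continuous.mul (hdir v _ (hdir v χ hχ)).continuous).integrable_of_hasCompactSupport
      (hdc v _ (hdc v χ hc)).mul_left
  have i2 : ∀ v : ℂ, Integrable (fun z => χ z * fderiv ℝ (fun w => fderiv ℝ f w v) z v) :=
    fun v => (hχ.continuous.mul (hdir v _ (hdir v f hf)).continuous).integrable_of_hasCompactSupport
      hc.mul_right
  have e : ∀ g k : ℂ → ℝ, ContDiff ℝ ∞ k → (fun z => g z * O1Metric.ddcDensity k z) =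
      fun z => (4 * Real.pi)⁻¹ * (g z * fderiv ℝ (fun w => fderiv ℝ k w 1) z 1
        + g z * fderiv ℝ (fun w => fderiv ℝ k w Complex.I) z Complex.I) := by
    intro g k hk
    ext z
    rw [O1Metric.ddcDensity, laplacian_eq_fderiv (hk.of_le (by norm_cast))]
    ring
  rw [e f χ hχ, e χ f hf, integral_const_mul, integral_const_mul, integral_add (i1 _) (i1 _),
    integral_add (i2 _) (i2 _), two, two]

end Laplacian

/-- A measurable function on `ℂ` that is almost everywhere invariant under each rotation is almost
everywhere equal to a radial one. -/
theorem exists_radial_ae_eq {h : ℂ → ℝ} (hm : Measurable h)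
    (hinv : ∀ c : Circle, ∀ᵐ z : ℂ, h (c * z) = h z) :
    ∃ k : ℝ → ℝ, Measurable k ∧ ∀ᵐ z : ℂ, h z = k ‖z‖ := by
  let ν : Measure UnitAddCircle := AddCircle.haarAddCircle
  have hmeas : Measurable fun p : UnitAddCircle × ℂ => h ((p.1.toCircle : ℂ) * p.2) := by
    refine hm.comp (Continuous.measurable ?_)
    exact (continuous_subtype_val.comp (AddCircle.continuous_toCircle.comp continuous_fst)).mul
      continuous_snd
  -- The radial representative is the average of h over the circle of radius r.
  refine ⟨fun r => ∫ s, h ((s.toCircle : ℂ) * (r : ℂ)) ∂ν, ?_, ?_⟩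
  · have : Measurable fun p : ℝ × UnitAddCircle => h ((p.2.toCircle : ℂ) * (p.1 : ℂ)) :=
      hmeas.comp (measurable_snd.prodMk (Complex.measurable_ofReal.comp measurable_fst))
    exact this.stronglyMeasurable.integral_prod_right.measurable
  · have h1 : ∀ᵐ s ∂ν, ∀ᵐ z : ℂ, h ((s.toCircle : ℂ) * z) = h z :=
      Filter.Eventually.of_forall fun s => hinv _
    -- Fubini exchanges "for every rotation, almost every z" for "for almost every z, almost every
    -- rotation". Invariance of Haar measure then absorbs the argument of z.
    have h1 := (Measure.ae_ae_comm (p := fun (s : UnitAddCircle) (z : ℂ) =>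
      h ((s.toCircle : ℂ) * z) = h z) (measurableSet_eq_fun hmeas (hm.comp measurable_snd))).1 h1
    filter_upwards [h1] with z hz
    obtain ⟨c, hc⟩ : ∃ c : Circle, z = c * (‖z‖ : ℂ) := by
      refine ⟨Circle.exp z.arg, ?_⟩
      rw [Circle.coe_exp, mul_comm, Complex.norm_mul_exp_arg_mul_I]
    obtain ⟨s₀, rfl⟩ := (AddCircle.homeomorphCircle (one_ne_zero : (1 : ℝ) ≠ 0)).surjective c
    rw [AddCircle.homeomorphCircle_apply] at hc
    calc h z = ∫ s, h z ∂ν := by simp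
      _ = ∫ s, h ((s.toCircle : ℂ) * z) ∂ν := integral_congr_ae (hz.mono fun _ h => h.symm)
      _ = ∫ s, h (((s + s₀).toCircle : ℂ) * (‖z‖ : ℂ)) ∂ν := by
        congr 1
        ext s
        rw [AddCircle.toCircle_add, Circle.coe_mul, mul_assoc, ← hc]
      _ = _ := integral_add_right_eq_self (μ := ν) (fun s => h ((s.toCircle : ℂ) * (‖z‖ : ℂ))) s₀

/-! ### Curvature densities: the Fubini–Study case, uniqueness, segments, rotation invariance. -/

namespace O1Metric

theorem contDiff_log_one_add_norm_sq : ContDiff ℝ ∞ fun z : ℂ => Real.log (1 + ‖z‖ ^ 2) :=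
  (contDiff_const.add (contDiff_norm_sq ℝ)).log fun z => by positivity

theorem hasDerivAt_log_one_add {s : ℝ} (hs : 0 ≤ s) :
    HasDerivAt (fun s => Real.log (1 + s)) (1 + s)⁻¹ s := by
  simpa using ((hasDerivAt_id s).const_add 1).log (by simp; positivity)

theorem hasDerivAt_inv_one_add {s : ℝ} (hs : 0 ≤ s) :
    HasDerivAt (fun s => (1 + s)⁻¹) (-((1 + s) ^ 2)⁻¹) s := by
  have := ((hasDerivAt_id s).const_add 1).fun_inv (by simp; positivity)
  simpa [neg_div] using this

theorem fsDensity_eq (z : ℂ) : fsDensity z = (Real.pi * (1 + ‖z‖ ^ 2) ^ 2)⁻¹ := by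
  have := laplacian_comp_norm_sq (k := fun s => Real.log (1 + s)) (k' := fun s => (1 + s)⁻¹)
    (k'' := fun s => -((1 + s) ^ 2)⁻¹)
    (contDiff_log_one_add_norm_sq.of_le (by norm_cast))
    (fun s hs => hasDerivAt_log_one_add hs) (fun s hs => hasDerivAt_inv_one_add hs) z
  simp only [fsDensity, ddcDensity, fs]
  rw [this]
  have : (1 + ‖z‖ ^ 2) ≠ 0 := by positivity
  field_simp
  ring

theorem fsDensity_pos (z : ℂ) : 0 < fsDensity z := by
  rw [fsDensity_eq]
  have := Real.pi_pos
  positivity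

theorem fsDensity_le (z : ℂ) : fsDensity z ≤ Real.pi⁻¹ := by
  rw [fsDensity_eq]
  gcongr
  exact le_mul_of_one_le_right Real.pi_pos.le (one_le_pow₀ (by nlinarith [sq_nonneg ‖z‖]))

theorem continuous_fsDensity : Continuous fsDensity := by
  have : fsDensity = fun z : ℂ => (Real.pi * (1 + ‖z‖ ^ 2) ^ 2)⁻¹ := funext fsDensity_eq
  rw [this]
  refine Continuous.inv₀ (by fun_prop) fun z => ?_
  have := Real.pi_pos
  positivity

/-- The logarithm of the density of ω₀ is a constant minus 2Φ₀, so the Fubini–Study metric is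
Kähler–Einstein. -/
theorem ricDensity_eq (z : ℂ) : ricDensity z = 2 * fsDensity z := by
  have hk : (fun z => Real.log (fsDensity z)) =
      fun z : ℂ => -Real.log Real.pi - 2 * Real.log (1 + ‖z‖ ^ 2) := by
    ext w
    rw [fsDensity_eq, Real.log_inv, Real.log_mul Real.pi_ne_zero (by positivity), Real.log_pow]
    push_cast
    ring
  have := laplacian_comp_norm_sq (k := fun s => -Real.log Real.pi - 2 * Real.log (1 + s))
    (k' := fun s => -(2 * (1 + s)⁻¹))
    (k'' := fun s => -(2 * -((1 + s) ^ 2)⁻¹))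
    ((contDiff_const.sub (contDiff_const.mul contDiff_log_one_add_norm_sq)).of_le (by norm_cast))
    (fun s hs => by simpa using ((hasDerivAt_log_one_add hs).const_mul 2).const_sub (-Real.log Real.pi))
    (fun s hs => ((hasDerivAt_inv_one_add hs).const_mul 2).neg) z
  simp only [ricDensity, ddcDensity]
  rw [hk, this, fsDensity_eq]
  have : (1 + ‖z‖ ^ 2) ≠ 0 := by positivity
  field_simp
  ring

namespace IsCurvatureDensity

variable {Φ Ψ : O1Metric} {h h' : ℂ → ℝ}

theorem exists_bound (H : IsCurvatureDensity Φ h) :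
    ∃ C : ℝ, 0 ≤ C ∧ ∀ᵐ z : ℂ, 0 ≤ h z ∧ h z ≤ C * fsDensity z := by
  obtain ⟨C, hC⟩ := H.bounded
  refine ⟨max C 0, le_max_right _ _, ?_⟩
  filter_upwards [hC, H.nonneg] with z h1 h2
  exact ⟨h2, h1.trans (mul_le_mul_of_nonneg_right (le_max_left _ _) (fsDensity_pos z).le)⟩

theorem locallyIntegrable (H : IsCurvatureDensity Φ h) : LocallyIntegrable h := by
  obtain ⟨C, hC0, hC⟩ := H.exists_bound
  refine (locallyIntegrable_const (C * Real.pi⁻¹)).mono H.measurable.aestronglyMeasurable ?_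
  filter_upwards [hC] with z ⟨h1, h2⟩
  rw [Real.norm_of_nonneg h1, Real.norm_of_nonneg (mul_nonneg hC0 (by have := Real.pi_pos; positivity))]
  exact h2.trans (mul_le_mul_of_nonneg_left (fsDensity_le z) hC0)

theorem ae_eq (H : IsCurvatureDensity Φ h) (H' : IsCurvatureDensity Φ h') : ∀ᵐ z : ℂ, h z = h' z :=
  ae_eq_of_integral_contDiff_smul_eq H.locallyIntegrable H'.locallyIntegrable fun χ h1 h2 => by
    simp only [smul_eq_mul]
    rw [← H.weak χ h1 h2, ← H'.weak χ h1 h2]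

/-- Removes the arbitrary choice in `curvature`: integrals may be computed with any density at hand.
-/
theorem ae_eq_curvature (H : IsCurvatureDensity Φ h) : ∀ᵐ z : ℂ, curvature Φ z = h z := by
  have hm : MemH11 Φ := ⟨h, H⟩
  rw [curvature, dif_pos hm]
  exact ae_eq hm.choose_spec H

/-- Inversion is differentiable away from 0, hence maps null sets to null sets. -/
theorem ae_inv {p : ℂ → Prop} (hp : ∀ᵐ z : ℂ, p z) : ∀ᵐ w : ℂ, p w⁻¹ := by
  have h1 : volume ({z : ℂ | ¬ p z} \ {0}) = 0 := measure_mono_null sdiff_subset hp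
  have h2 := addHaar_image_eq_zero_of_differentiableOn_of_addHaar_eq_zero (f := fun z : ℂ => z⁻¹)
    volume (fun z hz => ((differentiableAt_inv (𝕜 := ℂ) hz.2).restrictScalars ℝ).differentiableWithinAt) h1
  have h4 : ∀ᵐ w : ℂ, w ≠ 0 := by simp [ae_iff]
  filter_upwards [h4, measure_eq_zero_iff_ae_notMem.1 h2] with w hw hw'
  by_contra hcon
  exact hw' ⟨w⁻¹, ⟨hcon, by simpa using hw⟩, by simp⟩

/-- The form ω₀ is invariant under w = 1/z, so the bound by a multiple of ω₀ stays a bound by a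
constant in the chart at infinity, even near w = 0. -/
theorem locallyIntegrable_inf (H : IsCurvatureDensity Φ h) :
    LocallyIntegrable fun w : ℂ => h w⁻¹ / ‖w‖ ^ 4 := by
  obtain ⟨C, hC0, hC⟩ := H.exists_bound
  have hm : Measurable fun w : ℂ => h w⁻¹ / ‖w‖ ^ 4 :=
    (H.measurable.comp measurable_inv).div (measurable_norm.pow_const 4)
  refine (locallyIntegrable_const (C * Real.pi⁻¹)).mono hm.aestronglyMeasurable ?_
  have h4 : ∀ᵐ w : ℂ, w ≠ 0 := by simp [ae_iff]
  filter_upwards [ae_inv hC, h4] with z ⟨h1, h2⟩ hz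
  have hz' : 0 < ‖z‖ := norm_pos_iff.2 hz
  rw [Real.norm_of_nonneg (by positivity), Real.norm_of_nonneg (mul_nonneg hC0 (by have := Real.pi_pos; positivity))]
  rw [div_le_iff₀ (by positivity), mul_assoc]
  refine h2.trans (mul_le_mul_of_nonneg_left ?_ hC0)
  rw [fsDensity_eq, norm_inv, mul_inv]
  gcongr
  rw [inv_le_iff_one_le_mul₀ (by positivity)]
  have : ‖z‖ ^ 4 * (1 + ‖z‖⁻¹ ^ 2) ^ 2 = (‖z‖ ^ 2 + 1) ^ 2 := by
    field_simp
  rw [this]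
  nlinarith [sq_nonneg ‖z‖]

/-- Both weak equations are linear in the pair of metric and density. This identifies the curvature
along the segments that define the energy. -/
theorem of_segment (H : IsCurvatureDensity Φ h) (H' : IsCurvatureDensity Ψ h') {t : ℝ}
    (ht : t ∈ Icc (0 : ℝ) 1) :
    IsCurvatureDensity (segment Φ Ψ t) fun z => (1 - t) * h z + t * h' z where
  measurable := (H.measurable.const_mul _).add (H'.measurable.const_mul _)
  nonneg := by
    filter_upwards [H.nonneg, H'.nonneg] with z h1 h2
    exact add_nonneg (mul_nonneg (by linarith [ht.2]) h1) (mul_nonneg ht.1 h2)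
  bounded := by
    obtain ⟨C, hC⟩ := H.bounded
    obtain ⟨C', hC'⟩ := H'.bounded
    refine ⟨(1 - t) * C + t * C', ?_⟩
    filter_upwards [hC, hC'] with z h1 h2
    linarith [mul_le_mul_of_nonneg_left h1 (show 0 ≤ 1 - t by linarith [ht.2]),
      mul_le_mul_of_nonneg_left h2 ht.1]
  weak χ hχ hc := by
    have hd := ddcDensity_continuous (hχ.of_le (by norm_cast))
    have hdc := ddcDensity_hasCompactSupport hc
    have i1 : Integrable fun z => Φ.weight z * ddcDensity χ z :=
      (Φ.continuous_weight.mul hd).integrable_of_hasCompactSupport hdc.mul_left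
    have i2 : Integrable fun z => Ψ.weight z * ddcDensity χ z :=
      (Ψ.continuous_weight.mul hd).integrable_of_hasCompactSupport hdc.mul_left
    have j1 := H.locallyIntegrable.integrable_smul_left_of_hasCompactSupport hχ.continuous hc
    have j2 := H'.locallyIntegrable.integrable_smul_left_of_hasCompactSupport hχ.continuous hc
    simp only [smul_eq_mul] at j1 j2
    calc _ = ∫ z, (1 - t) * (Φ.weight z * ddcDensity χ z) + t * (Ψ.weight z * ddcDensity χ z) := by
          congr 1; ext z; simp only [segment]; ring
      _ = ∫ z, (1 - t) * (χ z * h z) + t * (χ z * h' z) := by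
          rw [integral_add (i1.const_mul _) (i2.const_mul _), integral_add (j1.const_mul _) (j2.const_mul _)]
          simp only [integral_const_mul]
          rw [H.weak χ hχ hc, H'.weak χ hχ hc]
      _ = _ := by congr 1; ext z; ring
  weakInf χ hχ hc := by
    have hd := ddcDensity_continuous (hχ.of_le (by norm_cast))
    have hdc := ddcDensity_hasCompactSupport hc
    have i1 : Integrable fun z => Φ.weightInf z * ddcDensity χ z :=
      (Φ.continuous_weightInf.mul hd).integrable_of_hasCompactSupport hdc.mul_left
    have i2 : Integrable fun z => Ψ.weightInf z * ddcDensity χ z :=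
      (Ψ.continuous_weightInf.mul hd).integrable_of_hasCompactSupport hdc.mul_left
    have j1 := H.locallyIntegrable_inf.integrable_smul_left_of_hasCompactSupport hχ.continuous hc
    have j2 := H'.locallyIntegrable_inf.integrable_smul_left_of_hasCompactSupport hχ.continuous hc
    simp only [smul_eq_mul] at j1 j2
    calc _ = ∫ z, (1 - t) * (Φ.weightInf z * ddcDensity χ z)
            + t * (Ψ.weightInf z * ddcDensity χ z) := by
          congr 1; ext z; simp only [segment]; ring
      _ = ∫ z, (1 - t) * (χ z * (h z⁻¹ / ‖z‖ ^ 4)) + t * (χ z * (h' z⁻¹ / ‖z‖ ^ 4)) := by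
          rw [integral_add (i1.const_mul _) (i2.const_mul _), integral_add (j1.const_mul _) (j2.const_mul _)]
          simp only [integral_const_mul]
          rw [H.weakInf χ hχ hc, H'.weakInf χ hχ hc]
      _ = _ := by congr 1; ext z; ring

end IsCurvatureDensity

theorem isCurvatureDensity_fs : IsCurvatureDensity fs fsDensity where
  measurable := continuous_fsDensity.measurable
  nonneg := Filter.Eventually.of_forall fun z => (fsDensity_pos z).le
  bounded := ⟨1, Filter.Eventually.of_forall fun z => by simp⟩
  weak χ hχ hc := integral_mul_ddcDensity contDiff_log_one_add_norm_sq hχ hc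
  weakInf χ hχ hc := by
    refine (integral_mul_ddcDensity contDiff_log_one_add_norm_sq hχ hc).trans ?_
    refine integral_congr_ae ?_
    have h4 : ∀ᵐ w : ℂ, w ≠ 0 := by simp [ae_iff]
    filter_upwards [h4] with z hz
    have hz' : 0 < ‖z‖ := norm_pos_iff.2 hz
    congr 1
    change fsDensity z = _
    rw [fsDensity_eq, fsDensity_eq, norm_inv]
    field_simp
    ring

/-- Rotations preserve Lebesgue measure and commute with the Laplacian, so the rotation can be moved
onto the test function and then absorbed by the invariance of the weight. Local integrability turns
equality of all test integrals into equality almost everywhere. -/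
theorem ae_rotation_curvatureDensity {Φ : O1Metric} {h : ℂ → ℝ} (H : IsCurvatureDensity Φ h)
    (hS : Φ.IsS1Invariant) (c : Circle) : ∀ᵐ z : ℂ, h (c * z) = h z := by
  have mp : MeasurePreserving (rotation c) (volume : Measure ℂ) volume :=
    (rotation c).measurePreserving
  have me : MeasurableEmbedding (rotation c) :=
    (rotation c).toHomeomorph.toMeasurableEquiv.measurableEmbedding
  obtain ⟨C, hC0, hC⟩ := H.exists_bound
  have hloc : LocallyIntegrable fun z : ℂ => h (c * z) := by
    refine (locallyIntegrable_const (C * Real.pi⁻¹)).mono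
      (H.measurable.comp (measurable_const_mul _)).aestronglyMeasurable ?_
    have := mp.quasiMeasurePreserving.ae hC
    filter_upwards [this] with z ⟨h1, h2⟩
    rw [rotation_apply] at h1 h2
    rw [Real.norm_of_nonneg h1,
      Real.norm_of_nonneg (mul_nonneg hC0 (by have := Real.pi_pos; positivity))]
    exact h2.trans (mul_le_mul_of_nonneg_left (fsDensity_le _) hC0)
  refine ae_eq_of_integral_contDiff_smul_eq hloc H.locallyIntegrable fun χ hχ hc => ?_
  simp only [smul_eq_mul]
  let χ' : ℂ → ℝ := fun z => χ ((c⁻¹ : Circle) * z)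
  have hχ' : ContDiff ℝ ∞ χ' := hχ.comp (contDiff_const.mul contDiff_id)
  have hc' : HasCompactSupport χ' := hc.comp_homeomorph (rotation c⁻¹).toHomeomorph
  calc ∫ z, χ z * h (c * z) = ∫ z, (fun w => χ' w * h w) (rotation c z) := by
        congr 1; ext z
        simp only [χ', rotation_apply]
        rw [← mul_assoc, ← Circle.coe_mul, inv_mul_cancel, Circle.coe_one, one_mul]
    _ = ∫ z, χ' z * h z := mp.integral_comp me (fun w => χ' w * h w)
    _ = ∫ z, Φ.weight z * ddcDensity χ' z := (H.weak χ' hχ' hc').symm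
    _ = ∫ z, (fun w => Φ.weight w * ddcDensity χ' w) (rotation c z) := 
        (mp.integral_comp me (fun w => Φ.weight w * ddcDensity χ' w)).symm
    _ = ∫ z, Φ.weight z * ddcDensity χ z := by
        congr 1; ext z
        simp only [rotation_apply, hS c z, ddcDensity, χ']
        rw [laplacian_comp_rotation (hχ.of_le (by norm_cast)), ← mul_assoc (c⁻¹ : Circle).1]
        rw [← Circle.coe_mul, inv_mul_cancel, Circle.coe_one, one_mul]
    _ = _ := H.weak χ hχ hc

end O1Metric

/-! ### The Fubini–Study metric in the logarithmic coordinate. -/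

/-- The Fubini–Study potential in the coordinate `x = log |z|²`. -/
noncomputable def fsPotential (x : ℝ) : ℝ := Real.log (1 + Real.exp x)

/-- The derivative of `fsPotential`. -/
noncomputable def fsMoment (x : ℝ) : ℝ := Real.exp x / (1 + Real.exp x)

/-- The second derivative of `fsPotential`. -/
noncomputable def fsLogDensity (x : ℝ) : ℝ := Real.exp x / (1 + Real.exp x) ^ 2

theorem hasDerivAt_fsPotential (x : ℝ) : HasDerivAt fsPotential (fsMoment x) x :=
  ((Real.hasDerivAt_exp x).const_add 1).log (by positivity)

theorem hasDerivAt_fsMoment (x : ℝ) : HasDerivAt fsMoment (fsLogDensity x) x := by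
  have := (Real.hasDerivAt_exp x).fun_div ((Real.hasDerivAt_exp x).const_add 1)
    (by positivity : 1 + Real.exp x ≠ 0)
  have e : fsLogDensity x = (Real.exp x * (1 + Real.exp x) - Real.exp x * Real.exp x) /
      (1 + Real.exp x) ^ 2 := by
    unfold fsLogDensity
    congr 1
    ring
  rw [e]
  exact this

theorem fsLogDensity_pos (x : ℝ) : 0 < fsLogDensity x := by
  unfold fsLogDensity; positivity

theorem fsMoment_pos (x : ℝ) : 0 < fsMoment x := by
  unfold fsMoment; positivity

theorem fsMoment_lt_one (x : ℝ) : fsMoment x < 1 := by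
  unfold fsMoment
  rw [div_lt_one (by positivity)]
  linarith

theorem fsLogDensity_eq (x : ℝ) : fsLogDensity x = fsMoment x * (1 - fsMoment x) := by
  unfold fsLogDensity fsMoment
  field_simp
  ring

theorem log_fsLogDensity (x : ℝ) : Real.log (fsLogDensity x) = x - 2 * fsPotential x := by
  unfold fsLogDensity fsPotential
  rw [Real.log_div (by positivity) (by positivity), Real.log_exp, Real.log_pow]
  push_cast
  ring

theorem continuous_fsLogDensity : Continuous fsLogDensity := by
  unfold fsLogDensity
  exact Continuous.div (by fun_prop) (by fun_prop) fun x => by positivity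

theorem fsLogDensity_le_exp_neg_abs (x : ℝ) : fsLogDensity x ≤ Real.exp (-|x|) := by
  unfold fsLogDensity
  rw [div_le_iff₀ (by positivity)]
  have h := Real.exp_pos x
  rcases abs_cases x with ⟨hx, -⟩ | ⟨hx, -⟩ <;> rw [hx]
  · rw [Real.exp_neg, inv_mul_eq_div, le_div_iff₀ h]
    nlinarith
  · rw [neg_neg]
    nlinarith [mul_pos h h, mul_pos h (mul_pos h h)]

theorem integrable_exp_neg_abs_div_two : Integrable fun x : ℝ => Real.exp (-|x| / 2) := by
  rw [← integrableOn_univ, ← Iic_union_Ioi (a := (0 : ℝ))]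
  refine IntegrableOn.union ?_ ?_
  · refine (integrableOn_exp_mul_Iic (a := 1 / 2) (by norm_num) 0).congr_fun ?_ measurableSet_Iic
    intro x hx
    simp only [abs_of_nonpos (mem_Iic.1 hx)]
    congr 1; ring
  · refine (integrableOn_exp_mul_Ioi (a := -1 / 2) (by norm_num) 0).congr_fun ?_ measurableSet_Ioi
    intro x hx
    simp only [abs_of_pos (mem_Ioi.1 hx)]
    congr 1; ring

theorem integrable_one_add_abs_mul_fsLogDensity :
    Integrable fun x => (1 + |x|) * fsLogDensity x := by
  refine (integrable_exp_neg_abs_div_two.const_mul 2).mono'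
    (by have := continuous_fsLogDensity; fun_prop) (Filter.Eventually.of_forall fun x => ?_)
  have h0 := abs_nonneg x
  rw [Real.norm_of_nonneg (mul_nonneg (by positivity) (fsLogDensity_pos x).le)]
  have h1 : 1 + |x| ≤ 2 * Real.exp (|x| / 2) := by
    have := Real.add_one_le_exp (|x| / 2)
    linarith
  calc _ ≤ (2 * Real.exp (|x| / 2)) * Real.exp (-|x|) :=
        mul_le_mul h1 (fsLogDensity_le_exp_neg_abs x) (fsLogDensity_pos x).le (by positivity)
    _ = _ := by rw [mul_assoc, ← Real.exp_add]; congr 2; ring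

/-- A function with at most linear growth is integrable against a density dominated by the
Fubini–Study one. -/
theorem integrable_mul_of_linear_growth {f H : ℝ → ℝ} {A C : ℝ} (hf : AEStronglyMeasurable f)
    (hH : AEStronglyMeasurable H) (hfA : ∀ x, |f x| ≤ A * (1 + |x|))
    (hHC : ∀ x, |H x| ≤ C * fsLogDensity x) : Integrable fun x => f x * H x := by
  refine (integrable_one_add_abs_mul_fsLogDensity.const_mul (A * C)).mono' (hf.mul hH)
    (Filter.Eventually.of_forall fun x => ?_)
  rw [Real.norm_eq_abs, abs_mul]
  calc _ ≤ (A * (1 + |x|)) * (C * fsLogDensity x) :=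
        mul_le_mul (hfA x) (hHC x) (abs_nonneg _) ((abs_nonneg _).trans (hfA x))
    _ = _ := by ring

theorem integrable_of_le_fsLogDensity {H : ℝ → ℝ} {C : ℝ} (hH : AEStronglyMeasurable H)
    (hHC : ∀ x, |H x| ≤ C * fsLogDensity x) : Integrable H := by
  simpa using integrable_mul_of_linear_growth (f := fun _ => 1) (A := 1)
    aestronglyMeasurable_const hH (fun x => by simp) hHC

/-! ### Behaviour at the poles and the energy functionals. -/

namespace O1Metric

theorem continuous_logWeight (Φ : O1Metric) : Continuous Φ.logWeight := by
  unfold logWeight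
  have := Φ.continuous_weight
  fun_prop

theorem weight_eq_norm {Φ : O1Metric} (hS : Φ.IsS1Invariant) (z : ℂ) :
    Φ.weight z = Φ.weight (‖z‖ : ℝ) := by
  conv_lhs => rw [← Complex.norm_mul_exp_arg_mul_I z, mul_comm, ← Circle.coe_exp]
  exact hS _ _

theorem tendsto_logWeight_atBot (Φ : O1Metric) :
    Filter.Tendsto Φ.logWeight Filter.atBot (nhds (Φ.weight 0)) := by
  have h : Filter.Tendsto (fun x : ℝ => ((Real.exp (x / 2) : ℝ) : ℂ)) Filter.atBot (nhds 0) := by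
    rw [← Complex.ofReal_zero]
    exact (Complex.continuous_ofReal.tendsto 0).comp
      (Real.tendsto_exp_atBot.comp (Filter.tendsto_id.atBot_div_const two_pos))
  exact (Φ.continuous_weight.tendsto 0).comp h

/-- With w = exp (-x/2) the gluing term log |w|² is exactly -x, so this is continuity of the second
weight at w = 0. -/
theorem tendsto_logWeight_sub_atTop (Φ : O1Metric) :
    Filter.Tendsto (fun x => Φ.logWeight x - x) Filter.atTop (nhds (Φ.weightInf 0)) := by
  have h : Filter.Tendsto (fun x : ℝ => ((Real.exp (-x / 2) : ℝ) : ℂ)) Filter.atTop (nhds 0) := by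
    rw [← Complex.ofReal_zero]
    exact (Complex.continuous_ofReal.tendsto 0).comp (Real.tendsto_exp_atBot.comp
      (Filter.tendsto_neg_atTop_atBot.atBot_div_const two_pos))
  refine ((Φ.continuous_weightInf.tendsto 0).comp h).congr fun x => ?_
  have hne : ((Real.exp (-x / 2) : ℝ) : ℂ) ≠ 0 := by
    exact_mod_cast (Real.exp_pos _).ne'
  rw [Function.comp_apply, Φ.compat _ hne, Complex.norm_real, Real.norm_of_nonneg (Real.exp_pos _).le,
    Real.log_pow, Real.log_exp, ← Complex.ofReal_inv, ← Real.exp_neg, logWeight]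
  rw [show -(-x / 2) = x / 2 by ring]
  push_cast
  ring

/-- The difference of two metrics is a continuous function on the compact sphere, which the closed
unit discs of the two charts cover; the logarithmic gluing terms cancel. -/
theorem exists_bound_weight_sub (Φ Ψ : O1Metric) :
    ∃ B : ℝ, ∀ z, |Φ.weight z - Ψ.weight z| ≤ B := by
  obtain ⟨B1, h1⟩ := (isCompact_closedBall (0 : ℂ) 1).exists_bound_of_continuousOn
    (f := fun z => Φ.weight z - Ψ.weight z)
    (Φ.continuous_weight.sub Ψ.continuous_weight).continuousOn
  obtain ⟨B2, h2⟩ := (isCompact_closedBall (0 : ℂ) 1).exists_bound_of_continuousOn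
    (f := fun z => Φ.weightInf z - Ψ.weightInf z)
    (Φ.continuous_weightInf.sub Ψ.continuous_weightInf).continuousOn
  refine ⟨max B1 B2, fun z => ?_⟩
  rcases le_total ‖z‖ 1 with hz | hz
  · exact (h1 z (by simpa using hz)).trans (le_max_left _ _)
  · have hz0 : z ≠ 0 := norm_pos_iff.1 (by linarith)
    have := h2 z⁻¹ (by simpa using inv_le_one_of_one_le₀ hz)
    rw [Φ.compat _ (inv_ne_zero hz0), Ψ.compat _ (inv_ne_zero hz0), inv_inv,
      add_sub_add_right_eq_sub] at this
    exact this.trans (le_max_right _ _)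

theorem fsDensity_radial (x : ℝ) :
    Real.pi * Real.exp x * (Real.pi * (1 + Real.exp (x / 2) ^ 2) ^ 2)⁻¹ = fsLogDensity x := by
  have : Real.exp (x / 2) ^ 2 = Real.exp x := by rw [← Real.exp_nat_mul]; congr 1; push_cast; ring
  rw [this, fsLogDensity]
  have := Real.pi_pos
  field_simp

theorem integrable_fsDensity : Integrable fsDensity := by
  have := (integrable_radial fun r => (Real.pi * (1 + r ^ 2) ^ 2)⁻¹).2 (by
    simp only [fsDensity_radial]
    exact integrable_of_le_fsLogDensity (C := 1) continuous_fsLogDensity.aestronglyMeasurable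
      fun x => by rw [one_mul, abs_of_pos (fsLogDensity_pos x)])
  exact this.congr (Filter.Eventually.of_forall fun z => (fsDensity_eq z).symm)

theorem integral_fsDensity_pos : 0 < ∫ z, fsDensity z := by
  rw [integral_pos_iff_support_of_nonneg (fun z => (fsDensity_pos z).le) integrable_fsDensity]
  have : Function.support fsDensity = univ := by
    ext z; simp [(fsDensity_pos z).ne']
  simp [this]

theorem meanRic_eq : meanRic = 2 := by
  unfold meanRic
  simp only [ricDensity_eq]
  rw [integral_const_mul, mul_div_assoc, div_self integral_fsDensity_pos.ne', mul_one]

theorem IsCurvatureDensity.integrable {Φ : O1Metric} {h : ℂ → ℝ} (H : IsCurvatureDensity Φ h) :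
    Integrable h := by
  obtain ⟨C, hC0, hC⟩ := H.exists_bound
  refine (integrable_fsDensity.const_mul C).mono' H.measurable.aestronglyMeasurable ?_
  filter_upwards [hC] with z ⟨h1, h2⟩
  rwa [Real.norm_of_nonneg h1]

theorem IsCurvatureDensity.integrable_weight_sub_mul {Ψ : O1Metric} {h : ℂ → ℝ}
    (H : IsCurvatureDensity Ψ h) (Φ : O1Metric) :
    Integrable fun z => (Φ.weight z - fs.weight z) * h z := by
  obtain ⟨B, hB⟩ := exists_bound_weight_sub Φ fs
  exact H.integrable.bdd_mul
    (Φ.continuous_weight.sub fs.continuous_weight).aestronglyMeasurable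
    (Filter.Eventually.of_forall hB)

/-- Along the segment the curvature is (1 - t) ω₀ + t ω, so the integrand is affine in t and its
mean value is taken at the midpoint. -/
theorem energy_eq {Φ : O1Metric} {h : ℂ → ℝ} (H : IsCurvatureDensity Φ h) :
    energy Φ = (∫ z, (Φ.weight z - fs.weight z) * fsDensity z) +
      ∫ z, (Φ.weight z - fs.weight z) * h z := by
  set A := ∫ z, (Φ.weight z - fs.weight z) * fsDensity z
  set B := ∫ z, (Φ.weight z - fs.weight z) * h z
  have i1 := isCurvatureDensity_fs.integrable_weight_sub_mul Φ
  have i2 := H.integrable_weight_sub_mul Φ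
  have key : ∀ t ∈ Icc (0 : ℝ) 1,
      ∫ z, (Φ.weight z - fs.weight z) * (2 * curvature (segment fs Φ t) z)
        = 2 * A + t * (2 * (B - A)) := by
    intro t ht
    have hc := (isCurvatureDensity_fs.of_segment H ht).ae_eq_curvature
    calc _ = ∫ z, (2 * (1 - t)) * ((Φ.weight z - fs.weight z) * fsDensity z)
            + (2 * t) * ((Φ.weight z - fs.weight z) * h z) := by
          refine integral_congr_ae ?_
          filter_upwards [hc] with z hz
          rw [hz]; ring
      _ = _ := by
          rw [integral_add (i1.const_mul _) (i2.const_mul _), integral_const_mul,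
            integral_const_mul]
          ring
  unfold energy primitive
  rw [intervalIntegral.integral_congr (g := fun t => 2 * A + t * (2 * (B - A)))
    (fun t ht => key t (by simpa using ht))]
  rw [intervalIntegral.integral_add (by simp)
      (Continuous.intervalIntegrable (by fun_prop) _ _),
    intervalIntegral.integral_mul_const]
  simp
  ring

theorem ricEnergy_eq (Φ : O1Metric) :
    ricEnergy Φ = 2 * ∫ z, (Φ.weight z - fs.weight z) * fsDensity z := by
  unfold ricEnergy primitive
  simp only [intervalIntegral.integral_const, ricDensity_eq]
  rw [← integral_const_mul]
  simp only [sub_zero, one_smul]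
  congr 1; ext z; ring

/-- With R̄ = 2 the coefficient of E is 1, and subtracting 2 ∫ (Φ - Φ₀) ω₀ changes ω₀ + ω into ω -
ω₀. -/
theorem kEnergy_eq {Φ : O1Metric} {h : ℂ → ℝ} (H : IsCurvatureDensity Φ h) :
    kEnergy Φ = (∫ z, (Φ.weight z - fs.weight z) * (h z - fsDensity z)) +
      ∫ z, Real.log (h z / fsDensity z) * h z := by
  have i1 := isCurvatureDensity_fs.integrable_weight_sub_mul Φ
  have i2 := H.integrable_weight_sub_mul Φ
  have e : ∫ z, entropyIntegrand Φ z = ∫ z, Real.log (h z / fsDensity z) * h z := by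
    refine integral_congr_ae ?_
    filter_upwards [H.ae_eq_curvature] with z hz
    rw [entropyIntegrand, hz]
  rw [kEnergy, e, energy_eq H, ricEnergy_eq, meanRic_eq]
  simp only [mul_sub]
  rw [integral_sub i2 i1]
  ring

end O1Metric

/-! ### Reduction to one real variable. -/

/-- The function `ρ (log s)` on `s > 0`, extended by zero. -/
noncomputable def logComp (ρ : ℝ → ℝ) (s : ℝ) : ℝ := if 0 < s then ρ (Real.log s) else 0

theorem logComp_eventuallyEq {ρ : ℝ → ℝ} {s : ℝ} (hs : 0 < s) :
    logComp ρ =ᶠ[nhds s] fun s => ρ (Real.log s) := by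
  filter_upwards [Ioi_mem_nhds hs] with t ht
  rw [logComp, if_pos (mem_Ioi.1 ht)]

theorem exists_bound_of_hasCompactSupport {ρ : ℝ → ℝ} (hc : HasCompactSupport ρ) :
    ∃ R : ℝ, 0 < R ∧ ∀ x, R ≤ |x| → ρ x = 0 := by
  obtain ⟨R, hR⟩ := hc.isCompact.isBounded.subset_closedBall 0
  refine ⟨|R| + 1, by positivity, fun x hx => ?_⟩
  by_contra hne
  have := hR (subset_tsupport ρ hne)
  rw [mem_closedBall_zero_iff, Real.norm_eq_abs] at this
  linarith [le_abs_self R]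

/-- Compact support of ρ makes the function vanish for all s below a positive threshold. So there is
no singularity at s = 0, and composing with |z|² gives a test function on all of ℂ. -/
theorem contDiff_logComp {ρ : ℝ → ℝ} (hρ : ContDiff ℝ ∞ ρ) (hc : HasCompactSupport ρ) :
    ContDiff ℝ ∞ (logComp ρ) := by
  obtain ⟨R, hR0, hR⟩ := exists_bound_of_hasCompactSupport hc
  rw [contDiff_iff_contDiffAt]
  intro s
  rcases lt_or_ge 0 s with hs | hs
  · exact (hρ.contDiffAt.comp s (Real.contDiffAt_log.2 hs.ne')).congr_of_eventuallyEq
      (logComp_eventuallyEq hs)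
  · refine contDiffAt_const (c := (0 : ℝ)) |>.congr_of_eventuallyEq ?_
    filter_upwards [Iio_mem_nhds (hs.trans_lt (Real.exp_pos (-R)))] with t ht
    unfold logComp
    split_ifs with h
    · refine hR _ ?_
      have : Real.log t < -R := by rwa [Real.log_lt_iff_lt_exp h]
      rw [abs_of_neg (by linarith)]
      linarith
    · rfl

theorem deriv_logComp {ρ : ℝ → ℝ} (hρ : ContDiff ℝ ∞ ρ) {s : ℝ} (hs : 0 < s) :
    deriv (logComp ρ) s = deriv ρ (Real.log s) / s := by
  rw [(logComp_eventuallyEq hs).deriv_eq]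
  have := ((hρ.differentiable (by simp) (Real.log s)).hasDerivAt.comp s
    (Real.hasDerivAt_log hs.ne')).deriv
  simpa [Function.comp_def, div_eq_mul_inv] using this

theorem deriv_deriv_logComp {ρ : ℝ → ℝ} (hρ : ContDiff ℝ ∞ ρ) {s : ℝ} (hs : 0 < s) :
    deriv (deriv (logComp ρ)) s =
      (deriv (deriv ρ) (Real.log s) - deriv ρ (Real.log s)) / s ^ 2 := by
  have h : deriv (logComp ρ) =ᶠ[nhds s] fun s => deriv ρ (Real.log s) / s := by
    filter_upwards [Ioi_mem_nhds hs] with t ht using deriv_logComp hρ ht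
  have hρ' : ContDiff ℝ ∞ (deriv ρ) := (contDiff_infty_iff_deriv.1 hρ).2
  have h1 : HasDerivAt (fun s => deriv ρ (Real.log s)) (deriv (deriv ρ) (Real.log s) * s⁻¹) s :=
    (hρ'.differentiable (by simp) (Real.log s)).hasDerivAt.comp s (Real.hasDerivAt_log hs.ne')
  rw [h.deriv_eq, (h1.fun_div (hasDerivAt_id' s) hs.ne').deriv]
  field_simp

namespace O1Metric

variable {Φ : O1Metric} {h : ℂ → ℝ}

/-- The curvature density of an `S¹`-invariant metric is radial. -/
theorem IsCurvatureDensity.exists_radial (H : IsCurvatureDensity Φ h) (hS : Φ.IsS1Invariant) :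
    ∃ (k : ℝ → ℝ) (C : ℝ), Measurable k ∧
      (∀ r, 0 ≤ k r ∧ k r ≤ C * (Real.pi * (1 + r ^ 2) ^ 2)⁻¹) ∧ ∀ᵐ z : ℂ, h z = k ‖z‖ := by
  obtain ⟨C, hC0, hC⟩ := H.exists_bound
  obtain ⟨k, hk, hkz⟩ := exists_radial_ae_eq H.measurable (ae_rotation_curvatureDensity H hS)
  have hpos : ∀ r : ℝ, 0 ≤ C * (Real.pi * (1 + r ^ 2) ^ 2)⁻¹ := fun r => by
    have := Real.pi_pos
    positivity
  -- Truncating k makes the bounds hold at every r and changes nothing on almost every circle.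
  refine ⟨fun r => max 0 (min (k r) (C * (Real.pi * (1 + r ^ 2) ^ 2)⁻¹)), C, ?_, ?_, ?_⟩
  · fun_prop
  · exact fun r => ⟨le_max_left _ _, max_le (hpos r) (min_le_right _ _)⟩
  · filter_upwards [hkz, hC] with z h1 ⟨h2, h3⟩
    rw [fsDensity_eq] at h3
    rw [h1] at h2 h3
    rw [min_eq_left h3, max_eq_right h2, h1]

/-- Tests the curvature equation on χ(z) = ρ(log |z|²). For s = |z|² the first-order terms cancel,
the form ddᶜχ has density ρ''/(π s), and the polar Jacobian π eˣ removes the factor. -/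
theorem integral_logWeight_mul (H : IsCurvatureDensity Φ h) (hS : Φ.IsS1Invariant) {k : ℝ → ℝ}
    (hk : ∀ᵐ z : ℂ, h z = k ‖z‖) {ρ : ℝ → ℝ} (hρ : ContDiff ℝ ∞ ρ) (hc : HasCompactSupport ρ) :
    ∫ x, Φ.logWeight x * deriv (deriv ρ) x =
      ∫ x, ρ x * (Real.pi * Real.exp x * k (Real.exp (x / 2))) := by
  obtain ⟨R, hR0, hR⟩ := exists_bound_of_hasCompactSupport hc
  have hl := contDiff_logComp hρ hc
  let χ : ℂ → ℝ := fun z => logComp ρ (‖z‖ ^ 2)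
  have hχ : ContDiff ℝ ∞ χ := hl.comp (contDiff_norm_sq ℝ)
  have hχc : HasCompactSupport χ := by
    refine HasCompactSupport.intro (isCompact_closedBall (0 : ℂ) (Real.exp R)) fun z hz => ?_
    rw [mem_closedBall_zero_iff, not_le] at hz
    have h1 : 1 < Real.exp R := by simpa using hR0
    have h2 : 0 < ‖z‖ := by linarith
    simp only [χ, logComp, if_pos (by positivity : 0 < ‖z‖ ^ 2)]
    refine hR _ ?_
    have : R ≤ Real.log (‖z‖ ^ 2) := by
      rw [Real.le_log_iff_exp_le (by positivity)]
      nlinarith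
    exact this.trans (le_abs_self _)
  have hw := H.weak χ hχ hχc
  have hddc : ∀ z : ℂ, ddcDensity χ z = (4 * Real.pi)⁻¹ *
      (4 * deriv (logComp ρ) (‖z‖ ^ 2) + 4 * ‖z‖ ^ 2 * deriv (deriv (logComp ρ)) (‖z‖ ^ 2)) := by
    intro z
    rw [ddcDensity, laplacian_comp_norm_sq (k := logComp ρ) (hχ.of_le (by norm_cast))
      (fun s _ => (hl.differentiable (by simp) s).hasDerivAt)
      (fun s _ => ((contDiff_infty_iff_deriv.1 hl).2.differentiable (by simp) s).hasDerivAt)]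
  have hsq : ∀ x : ℝ, Real.exp (x / 2) ^ 2 = Real.exp x := fun x => by
    rw [← Real.exp_nat_mul]; congr 1; push_cast; ring
  have e1 : ∫ z, Φ.weight z * ddcDensity χ z = ∫ x, Φ.logWeight x * deriv (deriv ρ) x := by
    have := integral_radial fun r => Φ.weight (r : ℝ) * ((4 * Real.pi)⁻¹ *
      (4 * deriv (logComp ρ) (r ^ 2) + 4 * r ^ 2 * deriv (deriv (logComp ρ)) (r ^ 2)))
    simp only [hddc]
    simp only [← weight_eq_norm hS] at this
    rw [this]
    congr 1
    ext x
    rw [hsq, deriv_logComp hρ (Real.exp_pos x), deriv_deriv_logComp hρ (Real.exp_pos x),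
      Real.log_exp, logWeight]
    have := Real.pi_pos
    field_simp
    ring
  have e2 : ∫ z, χ z * h z = ∫ x, ρ x * (Real.pi * Real.exp x * k (Real.exp (x / 2))) := by
    have := integral_radial fun r => logComp ρ (r ^ 2) * k r
    rw [integral_congr_ae (g := fun z => logComp ρ (‖z‖ ^ 2) * k ‖z‖)
      (by filter_upwards [hk] with z hz; rw [hz]), this]
    congr 1
    ext x
    rw [hsq, logComp, if_pos (Real.exp_pos x), Real.log_exp]
    ring
  rw [← e1, hw, e2]

/-- Reduction of the K-energy of an `S¹`-invariant metric to the coordinate `x = log |z|²`. -/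
theorem exists_logDensity (hΦ : Φ.MemH11) (hS : Φ.IsS1Invariant) :
    ∃ (H : ℝ → ℝ) (C : ℝ), Measurable H ∧ (∀ x, 0 ≤ H x) ∧ (∀ x, H x ≤ C * fsLogDensity x) ∧
      (∀ ρ : ℝ → ℝ, ContDiff ℝ ∞ ρ → HasCompactSupport ρ →
        ∫ x, Φ.logWeight x * deriv (deriv ρ) x = ∫ x, ρ x * H x) ∧
      (Integrable (fun x => Real.log (H x / fsLogDensity x) * H x) →
        Integrable Φ.entropyIntegrand) ∧
      Φ.kEnergy = (∫ x, (Φ.logWeight x - fsPotential x) * (H x - fsLogDensity x)) +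
        ∫ x, Real.log (H x / fsLogDensity x) * H x := by
  obtain ⟨h, hh⟩ := hΦ
  obtain ⟨k, C, hkm, hkC, hk⟩ := hh.exists_radial hS
  have hsq : ∀ x : ℝ, Real.exp (x / 2) ^ 2 = Real.exp x := fun x => by
    rw [← Real.exp_nat_mul]; congr 1; push_cast; ring
  have hdiv : ∀ x : ℝ, k (Real.exp (x / 2)) / (Real.pi * (1 + Real.exp (x / 2) ^ 2) ^ 2)⁻¹ =
      Real.pi * Real.exp x * k (Real.exp (x / 2)) / fsLogDensity x := fun x => by
    rw [← fsDensity_radial]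
    rw [mul_div_mul_left _ _ (by have := Real.pi_pos; positivity)]
  have hent : ∀ᵐ z : ℂ, Φ.entropyIntegrand z =
      Real.log (k ‖z‖ / (Real.pi * (1 + ‖z‖ ^ 2) ^ 2)⁻¹) * k ‖z‖ := by
    filter_upwards [hk, hh.ae_eq_curvature] with z h1 h2
    rw [entropyIntegrand, h2, h1, fsDensity_eq]
  refine ⟨fun x => Real.pi * Real.exp x * k (Real.exp (x / 2)), C, by fun_prop, fun x => ?_,
    fun x => ?_, fun ρ h1 h2 => integral_logWeight_mul hh hS hk h1 h2, fun hi => ?_, ?_⟩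
  · have := Real.pi_pos
    have := (hkC (Real.exp (x / 2))).1
    positivity
  · rw [← fsDensity_radial, ← mul_assoc, mul_comm C, mul_assoc _ C]
    exact mul_le_mul_of_nonneg_left (hkC _).2 (by have := Real.pi_pos; positivity)
  · have := (integrable_radial fun r => Real.log (k r / (Real.pi * (1 + r ^ 2) ^ 2)⁻¹) * k r).2 (by
      refine hi.congr (Filter.Eventually.of_forall fun x => ?_)
      simp only [hdiv]
      ring)
    exact this.congr (hent.mono fun z hz => hz.symm)
  · rw [kEnergy_eq hh]
    congr 1
    · have := integral_radial fun r => (Φ.weight (r : ℝ) - Real.log (1 + r ^ 2)) *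
        (k r - (Real.pi * (1 + r ^ 2) ^ 2)⁻¹)
      simp only [← weight_eq_norm hS] at this
      refine Eq.trans (integral_congr_ae ?_) (this.trans ?_)
      · filter_upwards [hk] with z hz
        rw [hz, fsDensity_eq]
        rfl
      · congr 1
        ext x
        rw [← fsDensity_radial, fsPotential, logWeight, hsq]
        ring
    · have := integral_radial fun r => Real.log (k r / (Real.pi * (1 + r ^ 2) ^ 2)⁻¹) * k r
      refine Eq.trans (integral_congr_ae ?_) (this.trans ?_)
      · filter_upwards [hk] with z hz
        rw [hz, fsDensity_eq]
      · congr 1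
        ext x
        rw [hdiv]
        ring

end O1Metric

/-! ### Potentials on the line: regularity from the weak equation. -/

section
open Filter Topology

/-- Absolute continuity on every compact interval. -/
def LocAC (f : ℝ → ℝ) : Prop := ∀ a b, AbsolutelyContinuousOnInterval f a b

namespace LocAC

variable {f g : ℝ → ℝ}

theorem add (hf : LocAC f) (hg : LocAC g) : LocAC fun x => f x + g x :=
  fun a b => (hf a b).add (hg a b)

theorem sub (hf : LocAC f) (hg : LocAC g) : LocAC fun x => f x - g x :=
  fun a b => (hf a b).sub (hg a b)

theorem mul (hf : LocAC f) (hg : LocAC g) : LocAC fun x => f x * g x :=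
  fun a b => (hf a b).mul (hg a b)

theorem of_contDiff (hf : ContDiff ℝ 1 f) : LocAC f :=
  fun _ _ => hf.contDiffOn.absolutelyContinuousOnInterval

theorem of_lipschitzWith {K : NNReal} (hf : LipschitzWith K f) : LocAC f :=
  fun _ _ => (hf.lipschitzOnWith (s := _)).absolutelyContinuousOnInterval

theorem of_hasDerivAt {f' : ℝ → ℝ} (hf : ∀ x, HasDerivAt f (f' x) x) (hc : Continuous f') :
    LocAC f := by
  refine of_contDiff (contDiff_one_iff_deriv.2 ⟨fun x => (hf x).differentiableAt, ?_⟩)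
  rwa [show deriv f = f' from funext fun x => (hf x).deriv]

/-- The fundamental theorem of calculus on the real line. -/
theorem integral_eq_sub {T T' : ℝ → ℝ} {m n : ℝ} (hT : LocAC T)
    (hd : ∀ᵐ x, HasDerivAt T (T' x) x) (hi : Integrable T') (hbot : Tendsto T atBot (𝓝 m))
    (htop : Tendsto T atTop (𝓝 n)) : ∫ x, T' x = n - m := by
  have h1 := intervalIntegral_tendsto_integral hi tendsto_neg_atTop_atBot tendsto_id
  refine tendsto_nhds_unique h1 ?_
  refine (htop.sub (hbot.comp tendsto_neg_atTop_atBot)).congr fun x => ?_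
  rw [Function.comp_apply, id, ← (hT (-x) x).integral_deriv_eq_sub]
  refine intervalIntegral.integral_congr_ae ?_
  filter_upwards [hd] with y hy _ using hy.deriv

end LocAC

theorem tendsto_of_hasCompactSupport {f : ℝ → ℝ} (hf : HasCompactSupport f) :
    Tendsto f atBot (𝓝 0) ∧ Tendsto f atTop (𝓝 0) := by
  obtain ⟨R, hR0, hR⟩ := exists_bound_of_hasCompactSupport hf
  constructor
  · refine tendsto_const_nhds.congr' ?_
    filter_upwards [Iic_mem_atBot (-R)] with x hx
    exact (hR x (by rw [mem_Iic] at hx; rw [abs_of_neg (by linarith)]; linarith)).symm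
  · refine tendsto_const_nhds.congr' ?_
    filter_upwards [Ici_mem_atTop R] with x hx
    exact (hR x ((mem_Ici.1 hx).trans (le_abs_self x))).symm

/-- A continuous function whose second distributional derivative vanishes is affine. -/
theorem sub_eq_sub_of_integral_mul_deriv_deriv_eq_zero {D : ℝ → ℝ} (hD : Continuous D)
    (hw : ∀ ρ : ℝ → ℝ, ContDiff ℝ ∞ ρ → HasCompactSupport ρ → ∫ x, D x * deriv (deriv ρ) x = 0)
    (x y : ℝ) : D (x + y) - D x = D y - D 0 := by
  -- Mollify with bumps of radius tending to 0. The mollified functions are affine, and the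
  -- difference identity, which does not mention the slope, passes to the pointwise limit.
  let η : ℕ → ContDiffBump (0 : ℝ) := fun n =>
    ⟨1 / (n + 2 : ℝ), 1 / (n + 1 : ℝ), by positivity, by gcongr; norm_num⟩
  have hη : Tendsto (fun n => (η n).rOut) atTop (𝓝 0) := tendsto_one_div_add_atTop_nhds_zero_nat
  let L := ContinuousLinearMap.lsmul (E := ℝ) ℝ ℝ
  have hlim : ∀ x, Tendsto (fun n => convolution ((η n).normed volume) D L volume x) atTop
      (𝓝 (D x)) := fun x => ContDiffBump.convolution_tendsto_right_of_continuous hη hD x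
  have haff : ∀ n, convolution ((η n).normed volume) D L volume (x + y)
      - convolution ((η n).normed volume) D L volume x =
      convolution ((η n).normed volume) D L volume y
      - convolution ((η n).normed volume) D L volume 0 := by
    intro n
    set f := (η n).normed volume
    have hf : ContDiff ℝ ∞ f := (η n).contDiff_normed
    have hfc : HasCompactSupport f := (η n).hasCompactSupport_normed
    have hf' : ContDiff ℝ ∞ (deriv f) := (contDiff_infty_iff_deriv.1 hf).2
    have d1 : ∀ x, HasDerivAt (convolution f D L volume) (convolution (deriv f) D L volume x) x :=
      fun x => hfc.hasDerivAt_convolution_left L (hf.of_le (by norm_cast)) hD.locallyIntegrable x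
    have d2 : ∀ x, HasDerivAt (convolution (deriv f) D L volume)
        (convolution (deriv (deriv f)) D L volume x) x :=
      fun x => hfc.deriv.hasDerivAt_convolution_left L (hf'.of_le (by norm_cast))
        hD.locallyIntegrable x
    -- Both derivatives fall on the mollifier, and the value at x is the hypothesis tested on t ↦ f
    -- (x - t).
    have hz : ∀ x, convolution (deriv (deriv f)) D L volume x = 0 := by
      intro x
      have e1 : deriv (fun t => f (x - t)) = fun t => -deriv f (x - t) := by
        ext t; exact deriv_comp_const_sub f x t
      have e2 : deriv (deriv fun t => f (x - t)) = fun t => deriv (deriv f) (x - t) := by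
        ext t
        rw [e1, deriv.fun_neg, deriv_comp_const_sub (deriv f) x t, neg_neg]
      have := hw (fun t => f (x - t)) (hf.comp (contDiff_const.sub contDiff_id))
        (hfc.comp_homeomorph (Homeomorph.subLeft x))
      rw [e2] at this
      rw [convolution_def, ← this, ← integral_sub_left_eq_self _ volume x]
      congr 1
      ext t
      simp [L, mul_comm]
    have hconst : ∀ x y, convolution (deriv f) D L volume x = convolution (deriv f) D L volume y :=
      is_const_of_deriv_eq_zero (fun x => (d2 x).differentiableAt) fun x => by
        rw [(d2 x).deriv, hz]
    have h3 : ∀ x y, convolution f D L volume x - convolution (deriv f) D L volume 0 * x =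
        convolution f D L volume y - convolution (deriv f) D L volume 0 * y := by
      have d3 : ∀ x, HasDerivAt (fun x => convolution f D L volume x
          - convolution (deriv f) D L volume 0 * x) 0 x := fun x => by
        have := (d1 x).sub ((hasDerivAt_id x).const_mul (convolution (deriv f) D L volume 0))
        rwa [hconst x 0, mul_one, sub_self] at this
      exact is_const_of_deriv_eq_zero (fun x => (d3 x).differentiableAt) fun x => (d3 x).deriv
    have := h3 (x + y) x
    have := h3 y 0
    linarith
  exact tendsto_nhds_unique (((hlim (x + y)).sub (hlim x)).congr haff) ((hlim y).sub (hlim 0))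

theorem tendsto_fsMoment_atBot : Tendsto fsMoment atBot (𝓝 0) := by
  have := Real.tendsto_exp_atBot.div (Real.tendsto_exp_atBot.const_add 1) (by norm_num)
  simp only [add_zero, zero_div] at this
  exact this

theorem one_sub_fsMoment (x : ℝ) : 1 - fsMoment x = (1 + Real.exp x)⁻¹ := by
  unfold fsMoment
  field_simp
  ring

theorem tendsto_fsMoment_atTop : Tendsto fsMoment atTop (𝓝 1) := by
  have : Tendsto (fun x => 1 - (1 + Real.exp x)⁻¹) atTop (𝓝 (1 - 0)) :=
    ((tendsto_atTop_add_const_left _ 1 Real.tendsto_exp_atTop).inv_tendsto_atTop).const_sub 1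
  rw [sub_zero] at this
  refine this.congr fun x => ?_
  rw [← one_sub_fsMoment]; ring

theorem integrable_fsLogDensity : Integrable fsLogDensity :=
  integrable_of_le_fsLogDensity (C := 1) continuous_fsLogDensity.aestronglyMeasurable
      fun x => by rw [one_mul, abs_of_pos (fsLogDensity_pos x)]

theorem integral_Iic_fsLogDensity (x : ℝ) : ∫ t in Iic x, fsLogDensity t = fsMoment x := by
  rw [integral_Iic_of_hasDerivAt_of_tendsto' (fun t _ => hasDerivAt_fsMoment t)
    integrable_fsLogDensity.integrableOn tendsto_fsMoment_atBot, sub_zero]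

theorem integral_Ioi_fsLogDensity (x : ℝ) : ∫ t in Ioi x, fsLogDensity t = 1 - fsMoment x :=
  integral_Ioi_of_hasDerivAt_of_tendsto' (fun t _ => hasDerivAt_fsMoment t)
    integrable_fsLogDensity.integrableOn tendsto_fsMoment_atTop

theorem fsMoment_le_exp (x : ℝ) : fsMoment x ≤ Real.exp x :=
  div_le_self (Real.exp_pos x).le (by linarith [Real.exp_pos x])

theorem one_sub_fsMoment_le_exp (x : ℝ) : 1 - fsMoment x ≤ Real.exp (-x) := by
  rw [one_sub_fsMoment, Real.exp_neg]
  gcongr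
  linarith

/-- A density on the real line dominated by the Fubini–Study one. -/
structure IsLogDensity (H : ℝ → ℝ) (C : ℝ) : Prop where
  measurable : Measurable H
  nonneg : ∀ x, 0 ≤ H x
  le : ∀ x, H x ≤ C * fsLogDensity x

/-- The primitive of `H` vanishing at `-∞`. -/
noncomputable def moment (H : ℝ → ℝ) (x : ℝ) : ℝ := ∫ t in Iic x, H t

namespace IsLogDensity

variable {H : ℝ → ℝ} {C : ℝ}

theorem const_nonneg (h : IsLogDensity H C) : 0 ≤ C :=
  nonneg_of_mul_nonneg_left ((h.nonneg 0).trans (h.le 0)) (fsLogDensity_pos 0)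

theorem abs_le (h : IsLogDensity H C) (x : ℝ) : |H x| ≤ C * fsLogDensity x := by
  rw [abs_of_nonneg (h.nonneg x)]; exact h.le x

theorem integrable (h : IsLogDensity H C) : Integrable H :=
  integrable_of_le_fsLogDensity h.measurable.aestronglyMeasurable h.abs_le

theorem integrable_mul (h : IsLogDensity H C) {f : ℝ → ℝ} {A : ℝ} (hf : Continuous f)
    (hfA : ∀ x, |f x| ≤ A * (1 + |x|)) : Integrable fun x => f x * H x :=
  integrable_mul_of_linear_growth hf.aestronglyMeasurable h.measurable.aestronglyMeasurable
    hfA h.abs_le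

theorem integrable_continuous_mul (h : IsLogDensity H C) {f : ℝ → ℝ} (hf : Continuous f)
    (hc : HasCompactSupport f) : Integrable fun x => f x * H x := by
  obtain ⟨B, hB⟩ := hc.exists_bound_of_continuous hf
  exact h.integrable.bdd_mul hf.aestronglyMeasurable (Eventually.of_forall hB)

theorem moment_sub (h : IsLogDensity H C) (x y : ℝ) :
    moment H y - moment H x = ∫ t in x..y, H t :=
  intervalIntegral.integral_Iic_sub_Iic h.integrable.integrableOn h.integrable.integrableOn

theorem ae_hasDerivAt_moment (h : IsLogDensity H C) : ∀ᵐ x, HasDerivAt (moment H) (H x) x := by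
  filter_upwards [LocallyIntegrable.ae_hasDerivAt_integral h.integrable.locallyIntegrable] with x hx
  refine ((hx 0).add_const (moment H 0)).congr_of_eventuallyEq (Eventually.of_forall fun y => ?_)
  have := h.moment_sub 0 y
  simp only
  linarith

theorem monotone_moment (h : IsLogDensity H C) : Monotone (moment H) := fun x y hxy => by
  rw [← sub_nonneg, h.moment_sub]
  exact intervalIntegral.integral_nonneg hxy fun t _ => h.nonneg t

theorem le_const (h : IsLogDensity H C) (x : ℝ) : H x ≤ C := by
  refine (h.le x).trans (mul_le_of_le_one_right h.const_nonneg ?_)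
  rw [fsLogDensity_eq]
  nlinarith [fsMoment_pos x, fsMoment_lt_one x]

theorem lipschitzWith_moment (h : IsLogDensity H C) :
    LipschitzWith ⟨C, h.const_nonneg⟩ (moment H) := by
  refine LipschitzWith.of_dist_le_mul fun x y => ?_
  rw [Real.dist_eq, h.moment_sub, Real.dist_eq, ← Real.norm_eq_abs]
  refine intervalIntegral.norm_integral_le_of_norm_le_const fun t _ => ?_
  rw [Real.norm_of_nonneg (h.nonneg t)]
  exact h.le_const t

theorem continuous_moment (h : IsLogDensity H C) : Continuous (moment H) :=
  h.lipschitzWith_moment.continuous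

theorem locAC_moment (h : IsLogDensity H C) : LocAC (moment H) :=
  LocAC.of_lipschitzWith h.lipschitzWith_moment

theorem moment_nonneg (h : IsLogDensity H C) (x : ℝ) : 0 ≤ moment H x :=
  integral_nonneg h.nonneg

theorem moment_le (h : IsLogDensity H C) (x : ℝ) : moment H x ≤ C * fsMoment x := by
  rw [← integral_Iic_fsLogDensity, ← integral_const_mul]
  exact integral_mono h.integrable.integrableOn
    (integrable_fsLogDensity.const_mul C).integrableOn h.le

theorem integral_sub_moment_le (h : IsLogDensity H C) (x : ℝ) :
    (∫ t, H t) - moment H x ≤ C * (1 - fsMoment x) := by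
  have := intervalIntegral.integral_Iic_add_Ioi (b := x) (h.integrable.integrableOn)
    (h.integrable.integrableOn)
  rw [← this, moment, add_sub_cancel_left, ← integral_Ioi_fsLogDensity, ← integral_const_mul]
  exact integral_mono h.integrable.integrableOn
    (integrable_fsLogDensity.const_mul C).integrableOn h.le

theorem moment_le_integral (h : IsLogDensity H C) (x : ℝ) : moment H x ≤ ∫ t, H t :=
  setIntegral_le_integral h.integrable (Eventually.of_forall h.nonneg)

theorem tendsto_moment_atBot (h : IsLogDensity H C) : Tendsto (moment H) atBot (𝓝 0) := by
  refine squeeze_zero h.moment_nonneg h.moment_le ?_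
  simpa using tendsto_fsMoment_atBot.const_mul C

theorem tendsto_moment_atTop (h : IsLogDensity H C) :
    Tendsto (moment H) atTop (𝓝 (∫ t, H t)) := by
  have h1 : Tendsto (fun x => C * (1 - fsMoment x)) atTop (𝓝 0) := by
    simpa using (tendsto_fsMoment_atTop.const_sub 1).const_mul C
  have h2 : Tendsto (fun x => (∫ t, H t) - moment H x) atTop (𝓝 0) :=
    squeeze_zero (fun x => sub_nonneg.2 (h.moment_le_integral x)) h.integral_sub_moment_le h1
  simpa using h2.const_sub (∫ t, H t)

theorem integrableOn_moment_Iic (h : IsLogDensity H C) (x : ℝ) :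
    IntegrableOn (moment H) (Iic x) := by
  have := integrableOn_exp_mul_Iic one_pos x
  simp only [one_mul] at this
  refine (this.const_mul C).mono' h.continuous_moment.aestronglyMeasurable
    (Eventually.of_forall fun t => ?_)
  rw [Real.norm_of_nonneg (h.moment_nonneg t)]
  exact (h.moment_le t).trans (mul_le_mul_of_nonneg_left (fsMoment_le_exp t) h.const_nonneg)

/-- A continuous function with second distributional derivative `H` and a limit at `-∞` has
derivative `moment H`. -/
theorem hasDerivAt_of_weak (h : IsLogDensity H C) {φ : ℝ → ℝ} {b : ℝ} (hφ : Continuous φ)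
    (hb : Tendsto φ atBot (𝓝 b))
    (hw : ∀ ρ : ℝ → ℝ, ContDiff ℝ ∞ ρ → HasCompactSupport ρ →
      ∫ x, φ x * deriv (deriv ρ) x = ∫ x, ρ x * H x) (x : ℝ) :
    HasDerivAt φ (moment H x) x := by
  -- The double primitive of H vanishing at -∞ solves the same weak equation as φ, so φ - ψ is
  -- affine.
  let ψ : ℝ → ℝ := fun x => ∫ t in Iic x, moment H t
  have hψd : ∀ x, HasDerivAt ψ (moment H x) x := by
    intro x
    have h1 := h.continuous_moment.integral_hasStrictDerivAt 0 x |>.hasDerivAt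
    refine (h1.add_const (ψ 0)).congr_of_eventuallyEq (Eventually.of_forall fun y => ?_)
    have := intervalIntegral.integral_Iic_sub_Iic (h.integrableOn_moment_Iic 0)
      (h.integrableOn_moment_Iic y)
    simp only [ψ]
    linarith
  have hψc : Continuous ψ := continuous_iff_continuousAt.2 fun x => (hψd x).continuousAt
  have hψb : Tendsto ψ atBot (𝓝 0) := by
    have e : Tendsto (fun x => C * Real.exp x) atBot (𝓝 0) := by
      simpa using Real.tendsto_exp_atBot.const_mul C
    refine squeeze_zero (fun x => integral_nonneg h.moment_nonneg) (fun x => ?_) e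
    have h1 := integral_exp_mul_Iic one_pos x
    have h2 := integrableOn_exp_mul_Iic one_pos x
    simp only [one_mul, div_one] at h1 h2
    rw [← h1, ← integral_const_mul]
    exact integral_mono (h.integrableOn_moment_Iic x) (h2.const_mul C) fun t =>
      (h.moment_le t).trans (mul_le_mul_of_nonneg_left (fsMoment_le_exp t) h.const_nonneg)
  have hψw : ∀ ρ : ℝ → ℝ, ContDiff ℝ ∞ ρ → HasCompactSupport ρ →
      ∫ x, ψ x * deriv (deriv ρ) x = ∫ x, ρ x * H x := by
    intro ρ hρ hc
    have hρ' := (contDiff_infty_iff_deriv.1 hρ).2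
    have hρ'' := (contDiff_infty_iff_deriv.1 hρ').2
    have i1 : Integrable fun x => ψ x * deriv (deriv ρ) x :=
      (hψc.mul hρ''.continuous).integrable_of_hasCompactSupport hc.deriv.deriv.mul_left
    have i2 := h.integrable_continuous_mul hρ.continuous hc
    have hT : LocAC fun x => ψ x * deriv ρ x - moment H x * ρ x :=
      ((LocAC.of_hasDerivAt hψd h.continuous_moment).mul
        (LocAC.of_contDiff (hρ'.of_le (by norm_cast)))).sub
        (h.locAC_moment.mul (LocAC.of_contDiff (hρ.of_le (by norm_cast))))
    have hTd : ∀ᵐ x, HasDerivAt (fun x => ψ x * deriv ρ x - moment H x * ρ x)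
        (ψ x * deriv (deriv ρ) x - ρ x * H x) x := by
      filter_upwards [h.ae_hasDerivAt_moment] with x hx
      have := ((hψd x).fun_mul (hρ'.differentiable (by simp) x).hasDerivAt).fun_sub
        (hx.fun_mul (hρ.differentiable (by simp) x).hasDerivAt)
      exact this.congr_deriv (by ring)
    have hTc : HasCompactSupport fun x => ψ x * deriv ρ x - moment H x * ρ x :=
      (hc.deriv.mul_left (f := ψ)).sub (hc.mul_left (f := moment H))
    have := hT.integral_eq_sub hTd (i1.sub i2) (tendsto_of_hasCompactSupport hTc).1
      (tendsto_of_hasCompactSupport hTc).2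
    rw [integral_sub i1 i2, sub_self] at this
    linarith
  have hD := sub_eq_sub_of_integral_mul_deriv_deriv_eq_zero (hφ.sub hψc) (fun ρ hρ hc => by
    have hρ'' := (contDiff_infty_iff_deriv.1 (contDiff_infty_iff_deriv.1 hρ).2).2
    have i1 : Integrable fun x => ψ x * deriv (deriv ρ) x :=
      (hψc.mul hρ''.continuous).integrable_of_hasCompactSupport hc.deriv.deriv.mul_left
    have i2 : Integrable fun x => φ x * deriv (deriv ρ) x :=
      (hφ.mul hρ''.continuous).integrable_of_hasCompactSupport hc.deriv.deriv.mul_left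
    simp only [Pi.sub_apply, sub_mul]
    rw [integral_sub i2 i1, hw ρ hρ hc, hψw ρ hρ hc, sub_self])
  have hconst : ∀ y, φ y - ψ y = φ 0 - ψ 0 := by
    intro y
    have l1 : Tendsto (fun x => φ x - ψ x) atBot (𝓝 (b - 0)) := hb.sub hψb
    -- A finite limit at -∞ forces the slope of the affine function φ - ψ to be 0.
    have l2 : Tendsto (fun x => (φ (x + y) - ψ (x + y)) - (φ x - ψ x)) atBot (𝓝 0) := by
      simpa using (l1.comp (tendsto_atBot_add_const_right _ y tendsto_id)).sub l1
    have l3 := l2.congr (fun x => hD x y)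
    have := tendsto_nhds_unique l3 tendsto_const_nhds
    simp only [Pi.sub_apply] at this
    linarith
  refine ((hψd x).add_const (φ 0 - ψ 0)).congr_of_eventuallyEq (Eventually.of_forall fun y => ?_)
  have := hconst y
  simp only
  linarith

/-- The total mass is the slope of φ at +∞: by the mean value theorem the unit increment φ(x+1) -
φ(x), which tends to 1, lies between the values of the monotone φ' at x and x + 1. -/
theorem integral_eq_one (h : IsLogDensity H C) {φ : ℝ → ℝ} {a : ℝ}
    (hφ : ∀ x, HasDerivAt φ (moment H x) x) (ha : Tendsto (fun x => φ x - x) atTop (𝓝 a)) :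
    ∫ x, H x = 1 := by
  have h1 : Tendsto (fun x => φ (x + 1) - φ x) atTop (𝓝 1) := by
    have := ((ha.comp (tendsto_atTop_add_const_right _ 1 tendsto_id)).sub ha).add_const 1
    simp only [sub_self, zero_add] at this
    refine this.congr fun x => ?_
    simp only [Function.comp_apply, id]
    ring
  have h2 : ∀ x, moment H x ≤ φ (x + 1) - φ x ∧ φ (x + 1) - φ x ≤ moment H (x + 1) := by
    intro x
    obtain ⟨c, hc, he⟩ := exists_hasDerivAt_eq_slope φ (moment H) (lt_add_one x)
      (fun y _ => (hφ y).continuousAt.continuousWithinAt) (fun y _ => hφ y)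
    rw [add_sub_cancel_left, div_one] at he
    rw [← he]
    exact ⟨h.monotone_moment hc.1.le, h.monotone_moment hc.2.le⟩
  exact tendsto_nhds_unique (tendsto_of_tendsto_of_tendsto_of_le_of_le h.tendsto_moment_atTop
    (h.tendsto_moment_atTop.comp (tendsto_atTop_add_const_right _ 1 tendsto_id))
    (fun x => (h2 x).1) (fun x => (h2 x).2)) h1

end IsLogDensity

end

/-! ### The energy identity and the values of the Legendre transform. -/

section
open Filter Topology

theorem tendsto_fsPotential_atBot : Tendsto fsPotential atBot (𝓝 0) := by
  have h : Tendsto (fun x => 1 + Real.exp x) atBot (𝓝 (1 + 0)) :=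
    Real.tendsto_exp_atBot.const_add 1
  have := h.log (by norm_num)
  rwa [add_zero, Real.log_one] at this

theorem fsPotential_sub (x : ℝ) : fsPotential x - x = fsPotential (-x) := by
  unfold fsPotential
  nth_rw 2 [← Real.log_exp x]
  rw [← Real.log_div (by positivity) (by positivity), Real.exp_neg]
  congr 1
  field_simp
  ring

theorem tendsto_fsPotential_sub_atTop : Tendsto (fun x => fsPotential x - x) atTop (𝓝 0) := by
  simp only [fsPotential_sub]
  exact tendsto_fsPotential_atBot.comp tendsto_neg_atTop_atBot

theorem tendsto_id_mul_exp_neg_atTop : Tendsto (fun x : ℝ => x * Real.exp (-x)) atTop (𝓝 0) := by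
  simpa using Real.tendsto_pow_mul_exp_neg_atTop_nhds_zero 1

theorem abs_le_of_hasDerivAt {f f' : ℝ → ℝ} (hf : ∀ x, HasDerivAt f (f' x) x)
    (h0 : ∀ x, 0 ≤ f' x) (h1 : ∀ x, f' x ≤ 1) (x : ℝ) : |f x| ≤ (|f 0| + 1) * (1 + |x|) := by
  have := Convex.norm_image_sub_le_of_norm_hasDerivWithin_le (f := f) (f' := f') (C := 1)
    (s := univ) (x := 0) (y := x) (fun x _ => (hf x).hasDerivWithinAt)
    (fun x _ => by rw [Real.norm_of_nonneg (h0 x)]; exact h1 x) convex_univ trivial trivial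
  rw [Real.norm_eq_abs, Real.norm_eq_abs, sub_zero, one_mul] at this
  have h2 := abs_sub_abs_le_abs_sub (f x) (f 0)
  nlinarith [abs_nonneg x, abs_nonneg (f 0)]

/-- The weight, in the coordinate `x = log |z|²`, of a metric with curvature density `H`. -/
structure IsLogPotential (φ H : ℝ → ℝ) (C a b : ℝ) : Prop where
  density : IsLogDensity H C
  hasDerivAt : ∀ x, HasDerivAt φ (moment H x) x
  tendsto_atBot : Tendsto φ atBot (𝓝 b)
  tendsto_atTop : Tendsto (fun x => φ x - x) atTop (𝓝 a)

namespace IsLogPotential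

variable {φ H : ℝ → ℝ} {C a b : ℝ}

theorem integral_eq_one (h : IsLogPotential φ H C a b) : ∫ x, H x = 1 :=
  h.density.integral_eq_one h.hasDerivAt h.tendsto_atTop

theorem moment_le_one (h : IsLogPotential φ H C a b) (x : ℝ) : moment H x ≤ 1 :=
  h.integral_eq_one ▸ h.density.moment_le_integral x

theorem one_sub_moment_le (h : IsLogPotential φ H C a b) (x : ℝ) :
    1 - moment H x ≤ C * Real.exp (-x) := by
  have := h.density.integral_sub_moment_le x
  rw [h.integral_eq_one] at this
  exact this.trans (mul_le_mul_of_nonneg_left (one_sub_fsMoment_le_exp x) h.density.const_nonneg)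

theorem moment_le_exp (h : IsLogPotential φ H C a b) (x : ℝ) :
    moment H x ≤ C * Real.exp x :=
  (h.density.moment_le x).trans
    (mul_le_mul_of_nonneg_left (fsMoment_le_exp x) h.density.const_nonneg)

theorem tendsto_moment_atTop (h : IsLogPotential φ H C a b) :
    Tendsto (moment H) atTop (𝓝 1) :=
  h.integral_eq_one ▸ h.density.tendsto_moment_atTop

theorem continuous (h : IsLogPotential φ H C a b) : Continuous φ :=
  continuous_iff_continuousAt.2 fun x => (h.hasDerivAt x).continuousAt

theorem monotone (h : IsLogPotential φ H C a b) : Monotone φ :=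
  monotone_of_hasDerivAt_nonneg h.hasDerivAt h.density.moment_nonneg

theorem monotone_sub (h : IsLogPotential φ H C a b) : Monotone fun x => x - φ x :=
  monotone_of_hasDerivAt_nonneg (fun x => (hasDerivAt_id x).fun_sub (h.hasDerivAt x))
    fun x => sub_nonneg.2 (h.moment_le_one x)

theorem le_apply (h : IsLogPotential φ H C a b) (x : ℝ) : b ≤ φ x :=
  h.monotone.le_of_tendsto h.tendsto_atBot x

theorem add_le_apply (h : IsLogPotential φ H C a b) (x : ℝ) : x + a ≤ φ x := by
  have h1 : Tendsto (fun x => x - φ x) atTop (𝓝 (-a)) := by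
    simpa using h.tendsto_atTop.neg
  have := h.monotone_sub.ge_of_tendsto h1 x
  linarith

/-- The exponential decay inherited from the Fubini–Study bound beats the linear factor; this and
the next lemmas remove boundary terms. -/
theorem tendsto_mul_moment_atBot (h : IsLogPotential φ H C a b) :
    Tendsto (fun x => x * moment H x) atBot (𝓝 0) := by
  have h1 : Tendsto (fun x : ℝ => C * (-x * Real.exp (- -x))) atBot (𝓝 0) := by
    simpa using (tendsto_id_mul_exp_neg_atTop.comp tendsto_neg_atBot_atTop).const_mul C
  refine squeeze_zero_norm' ?_ h1
  filter_upwards [Iic_mem_atBot 0] with x hx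
  rw [neg_neg, norm_mul, Real.norm_of_nonpos hx, Real.norm_of_nonneg (h.density.moment_nonneg x)]
  have := mul_le_mul_of_nonneg_left (h.moment_le_exp x) (neg_nonneg.2 (mem_Iic.1 hx))
  linarith

theorem tendsto_mul_one_sub_moment_atTop (h : IsLogPotential φ H C a b) :
    Tendsto (fun x => x * (1 - moment H x)) atTop (𝓝 0) := by
  have h1 : Tendsto (fun x : ℝ => C * (x * Real.exp (-x))) atTop (𝓝 0) := by
    simpa using tendsto_id_mul_exp_neg_atTop.const_mul C
  refine squeeze_zero_norm' ?_ h1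
  filter_upwards [Ici_mem_atTop 0] with x hx
  rw [norm_mul, Real.norm_of_nonneg hx, Real.norm_of_nonneg (sub_nonneg.2 (h.moment_le_one x))]
  have := mul_le_mul_of_nonneg_left (h.one_sub_moment_le x) (mem_Ici.1 hx)
  linarith

theorem tendsto_mul_one_sub_moment_of_sub (h : IsLogPotential φ H C a b) {ψ : ℝ → ℝ} {c : ℝ}
    (hψ : Tendsto (fun x => ψ x - x) atTop (𝓝 c)) :
    Tendsto (fun x => ψ x * (1 - moment H x)) atTop (𝓝 0) := by
  have := (hψ.mul (h.tendsto_moment_atTop.const_sub 1)).add h.tendsto_mul_one_sub_moment_atTop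
  simp only [sub_self, mul_zero, add_zero] at this
  exact this.congr fun x => by ring

theorem abs_le (h : IsLogPotential φ H C a b) (x : ℝ) : |φ x| ≤ (|φ 0| + 1) * (1 + |x|) :=
  abs_le_of_hasDerivAt h.hasDerivAt h.density.moment_nonneg h.moment_le_one x

theorem abs_id_mul_moment_le (h : IsLogPotential φ H C a b) (x : ℝ) :
    |x * moment H x| ≤ 1 * (1 + |x|) := by
  rw [abs_mul, abs_of_nonneg (h.density.moment_nonneg x)]
  nlinarith [h.moment_le_one x, abs_nonneg x]

theorem locAC (h : IsLogPotential φ H C a b) : LocAC φ :=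
  LocAC.of_hasDerivAt h.hasDerivAt h.density.continuous_moment

theorem integrable_mul (h : IsLogPotential φ H C a b) : Integrable fun x => φ x * H x :=
  h.density.integrable_mul h.continuous h.abs_le

theorem integrable_id_mul_moment_mul (h : IsLogPotential φ H C a b) :
    Integrable fun x => x * moment H x * H x :=
  h.density.integrable_mul (continuous_id.mul h.density.continuous_moment) h.abs_id_mul_moment_le

theorem integrable_legendre (h : IsLogPotential φ H C a b) :
    Integrable fun x => (x * moment H x - φ x) * H x := by
  simp only [sub_mul]
  exact h.integrable_id_mul_moment_mul.sub h.integrable_mul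

end IsLogPotential

theorem isLogDensity_fsLogDensity : IsLogDensity fsLogDensity 1 where
  measurable := continuous_fsLogDensity.measurable
  nonneg x := (fsLogDensity_pos x).le
  le x := by rw [one_mul]

theorem moment_fsLogDensity : moment fsLogDensity = fsMoment := funext integral_Iic_fsLogDensity

theorem isLogPotential_fs : IsLogPotential fsPotential fsLogDensity 1 0 0 where
  density := isLogDensity_fsLogDensity
  hasDerivAt x := by rw [moment_fsLogDensity]; exact hasDerivAt_fsPotential x
  tendsto_atBot := tendsto_fsPotential_atBot
  tendsto_atTop := tendsto_fsPotential_sub_atTop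

namespace IsLogPotential

variable {φ H : ℝ → ℝ} {C a b : ℝ}

theorem integrable_sub_mul_sub (h : IsLogPotential φ H C a b) :
    Integrable fun x => (φ x - fsPotential x) * (H x - fsLogDensity x) := by
  have h2 := isLogDensity_fsLogDensity.integrable_mul h.continuous h.abs_le
  have h3 := h.density.integrable_mul isLogPotential_fs.continuous isLogPotential_fs.abs_le
  have h4 := isLogPotential_fs.integrable_mul
  refine ((h.integrable_mul.sub h2).sub (h3.sub h4)).congr (Eventually.of_forall fun x => ?_)
  simp only [Pi.sub_apply]
  ring

theorem integrable_sub_two_mul (h : IsLogPotential φ H C a b) :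
    Integrable fun x => (x - 2 * fsPotential x) * H x := by
  have h1 := h.density.integrable_mul (f := fun x => x) (A := 1) continuous_id fun x => by
    linarith [abs_nonneg x]
  have h3 := h.density.integrable_mul isLogPotential_fs.continuous isLogPotential_fs.abs_le
  refine (h1.sub (h3.const_mul 2)).congr (Eventually.of_forall fun x => ?_)
  simp only [Pi.sub_apply]
  ring

/-- The identity between the energy terms and the Legendre transform. -/
theorem integral_energy (h : IsLogPotential φ H C a b) :
    (∫ x, (φ x - fsPotential x) * (H x - fsLogDensity x)) - (∫ x, (x - 2 * fsPotential x) * H x)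
      + 2 * ∫ x, (x * moment H x - φ x) * H x = 1 - a - b := by
  have hF := h.density.tendsto_moment_atBot
  -- An explicit primitive of the combined integrand, found by integrating by parts. The terms m -
  -- (1 - m)φ₀, with m = `fsMoment`, use m' = m(1 - m). Absolute continuity is needed because F has
  -- derivative H only almost everywhere.
  have hT : LocAC fun x => fsPotential x * moment H x - φ x * fsMoment x
      - (1 - fsMoment x) * fsPotential x + fsMoment x - x * moment H x + φ x
      + x * (moment H x * moment H x) - φ x * moment H x := by
    have a1 := isLogPotential_fs.locAC
    have a2 := h.density.locAC_moment
    have a3 := h.locAC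
    have a4 : LocAC fsMoment := LocAC.of_hasDerivAt hasDerivAt_fsMoment continuous_fsLogDensity
    have a5 : LocAC fun x => x := LocAC.of_contDiff contDiff_id
    have a6 : LocAC fun _ => 1 := LocAC.of_contDiff contDiff_const
    exact (((((((a1.mul a2).sub (a3.mul a4)).sub ((a6.sub a4).mul a1)).add a4).sub
      (a5.mul a2)).add a3).add (a5.mul (a2.mul a2))).sub (a3.mul a2)
  have hd : ∀ᵐ x, HasDerivAt (fun x => fsPotential x * moment H x - φ x * fsMoment x
      - (1 - fsMoment x) * fsPotential x + fsMoment x - x * moment H x + φ x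
      + x * (moment H x * moment H x) - φ x * moment H x)
      ((φ x - fsPotential x) * (H x - fsLogDensity x) - (x - 2 * fsPotential x) * H x
        + 2 * ((x * moment H x - φ x) * H x)) x := by
    filter_upwards [h.density.ae_hasDerivAt_moment] with x d2
    have d1 := hasDerivAt_fsPotential x
    have d3 := h.hasDerivAt x
    have d4 := hasDerivAt_fsMoment x
    have d5 := hasDerivAt_id' x
    refine ((((((((d1.fun_mul d2).fun_sub (d3.fun_mul d4)).fun_sub
      ((d4.const_sub 1).fun_mul d1)).fun_add d4).fun_sub (d5.fun_mul d2)).fun_add d3).fun_add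
      (d5.fun_mul (d2.fun_mul d2))).fun_sub (d3.fun_mul d2)).congr_deriv ?_
    rw [fsLogDensity_eq]
    ring
  have i1 := h.integrable_sub_mul_sub
  have i2 := h.integrable_sub_two_mul
  have i3 := h.integrable_legendre
  have hbot : Tendsto (fun x => fsPotential x * moment H x - φ x * fsMoment x
      - (1 - fsMoment x) * fsPotential x + fsMoment x - x * moment H x + φ x
      + x * (moment H x * moment H x) - φ x * moment H x) atBot (𝓝 b) := by
    have t1 := tendsto_fsPotential_atBot
    have t4 := tendsto_fsMoment_atBot
    have t3 := h.tendsto_atBot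
    have t5 := h.tendsto_mul_moment_atBot
    have := (((((((t1.mul hF).sub (t3.mul t4)).sub ((t4.const_sub 1).mul t1)).add t4).sub
      t5).add t3).add (t5.mul hF)).sub (t3.mul hF)
    simp only [mul_zero, sub_zero, add_zero, zero_add] at this
    exact this.congr fun x => by ring
  -- Single terms grow linearly. They are regrouped so that φ and φ₀ occur only after subtracting x,
  -- or multiplied by 1 - F or 1 - m, which decay exponentially.
  have htop : Tendsto (fun x => fsPotential x * moment H x - φ x * fsMoment x
      - (1 - fsMoment x) * fsPotential x + fsMoment x - x * moment H x + φ x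
      + x * (moment H x * moment H x) - φ x * moment H x) atTop (𝓝 (1 - a)) := by
    have t1 := tendsto_fsPotential_sub_atTop
    have t2 := h.tendsto_atTop
    have t3 := h.tendsto_mul_one_sub_moment_of_sub t1
    have t4 := h.tendsto_mul_one_sub_moment_of_sub t2
    have t5 := isLogPotential_fs.tendsto_mul_one_sub_moment_of_sub t1
    have t6 := isLogPotential_fs.tendsto_mul_one_sub_moment_of_sub t2
    rw [moment_fsLogDensity] at t5 t6
    have t7 := h.tendsto_mul_one_sub_moment_atTop.mul h.tendsto_moment_atTop
    have := (((((((t1.sub t2).sub t3).add t6).sub t5).add tendsto_fsMoment_atTop).sub t7).add t4)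
    have e : (0 - a - 0 + 0 - 0 + 1 - 0 * 1 + 0 : ℝ) = 1 - a := by ring
    rw [e] at this
    exact this.congr fun x => by ring
  have := hT.integral_eq_sub hd ((i1.sub i2).add (i3.const_mul 2)) hbot htop
  have i4 : Integrable fun x => (φ x - fsPotential x) * (H x - fsLogDensity x)
      - (x - 2 * fsPotential x) * H x := i1.sub i2
  rw [integral_add i4 (i3.const_mul 2), integral_sub i1 i2, integral_const_mul] at this
  exact this

/-- Where H vanishes both sides are 0, by the convention 0 log 0 = 0. -/
theorem log_div_fsLogDensity_mul (H : ℝ → ℝ) (x : ℝ) :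
    Real.log (H x / fsLogDensity x) * H x =
      H x * Real.log (H x) - (x - 2 * fsPotential x) * H x := by
  rcases eq_or_ne (H x) 0 with h0 | h0
  · simp [h0]
  · rw [Real.log_div h0 (fsLogDensity_pos x).ne', log_fsLogDensity]
    ring

/-- The ratio s = H / `fsLogDensity` stays in [0, C], where s log s is bounded, so the integrand is
at most a multiple of `fsLogDensity`. -/
theorem integrable_entropy (h : IsLogPotential φ H C a b) :
    Integrable fun x => Real.log (H x / fsLogDensity x) * H x := by
  obtain ⟨B, hB⟩ := (isCompact_Icc (a := (0 : ℝ)) (b := C)).exists_bound_of_continuousOn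
    Real.continuous_mul_log.continuousOn
  have hm := h.density.measurable
  have hm' := continuous_fsLogDensity.measurable
  refine (integrable_fsLogDensity.const_mul B).mono'
    (Measurable.aestronglyMeasurable (by fun_prop)) (Eventually.of_forall fun x => ?_)
  have hp := fsLogDensity_pos x
  have := hB (H x / fsLogDensity x) ⟨div_nonneg (h.density.nonneg x) hp.le,
    (div_le_iff₀ hp).2 (h.density.le x)⟩
  calc _ = ‖H x / fsLogDensity x * Real.log (H x / fsLogDensity x)‖ * fsLogDensity x := by
        rw [← Real.norm_of_nonneg hp.le, ← norm_mul, Real.norm_of_nonneg hp.le]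
        congr 1
        field_simp
    _ ≤ _ := mul_le_mul_of_nonneg_right this hp.le

theorem integrable_mul_log (h : IsLogPotential φ H C a b) :
    Integrable fun x => H x * Real.log (H x) := by
  refine (h.integrable_entropy.add h.integrable_sub_two_mul).congr
    (Eventually.of_forall fun x => ?_)
  simp only [Pi.add_apply, log_div_fsLogDensity_mul H]
  ring

theorem kEnergy_formula (h : IsLogPotential φ H C a b) :
    (∫ x, (φ x - fsPotential x) * (H x - fsLogDensity x)) +
        (∫ x, Real.log (H x / fsLogDensity x) * H x) =
      2 * (1 / 2 * (-b + -a) - ∫ x, (x * moment H x - φ x) * H x)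
        + (∫ x, H x * Real.log (H x)) + 1 := by
  simp only [log_div_fsLogDensity_mul H]
  rw [integral_sub h.integrable_mul_log h.integrable_sub_two_mul]
  linarith [h.integral_energy]

/-- Combine the asymptotes x + a ≤ φ and b ≤ φ with weights y and 1 - y. -/
theorem bddAbove_range (h : IsLogPotential φ H C a b) {y : ℝ} (hy : y ∈ Icc (0 : ℝ) 1) :
    BddAbove (range fun x => x * y - φ x) := by
  refine ⟨y * (-a) + (1 - y) * (-b), ?_⟩
  rintro _ ⟨x, rfl⟩
  have h1 := mul_le_mul_of_nonneg_left (h.add_le_apply x) hy.1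
  have h2 := mul_le_mul_of_nonneg_left (h.le_apply x) (sub_nonneg.2 hy.2)
  simp only
  linarith

theorem legendre_zero (h : IsLogPotential φ H C a b) : legendre φ 0 = -b := by
  refine le_antisymm (ciSup_le fun x => ?_) ?_
  · linarith [h.le_apply x]
  · exact le_of_tendsto' h.tendsto_atBot.neg fun x =>
      le_of_eq_of_le (by ring) (le_ciSup (h.bddAbove_range (y := 0) (by simp)) x)

theorem legendre_one (h : IsLogPotential φ H C a b) : legendre φ 1 = -a := by
  refine le_antisymm (ciSup_le fun x => ?_) ?_
  · linarith [h.add_le_apply x]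
  · exact le_of_tendsto' h.tendsto_atTop.neg fun x =>
      le_of_eq_of_le (by ring) (le_ciSup (h.bddAbove_range (y := 1) (by simp)) x)

/-- φ' is monotone, so φ is convex and lies above its tangent at x, whose slope is F(x): the
supremum is attained at x. -/
theorem legendre_moment (h : IsLogPotential φ H C a b) (x : ℝ) :
    legendre φ (moment H x) = x * moment H x - φ x := by
  have hy : moment H x ∈ Icc (0 : ℝ) 1 := ⟨h.density.moment_nonneg x, h.moment_le_one x⟩
  refine le_antisymm (ciSup_le fun t => ?_) (le_ciSup (h.bddAbove_range hy) x)
  have hc : ConvexOn ℝ univ φ := by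
    refine MonotoneOn.convexOn_of_deriv convex_univ h.continuous.continuousOn
      (fun x _ => (h.hasDerivAt x).differentiableAt.differentiableWithinAt) ?_
    rw [show deriv φ = moment H from funext fun x => (h.hasDerivAt x).deriv]
    exact h.density.monotone_moment.monotoneOn _
  rcases lt_trichotomy t x with htx | rfl | htx
  · have := hc.slope_le_of_hasDerivAt (mem_univ t) (mem_univ x) htx (h.hasDerivAt x)
    rw [slope_def_field, div_le_iff₀ (by linarith)] at this
    linarith
  · rfl
  · have := hc.le_slope_of_hasDerivAt (mem_univ x) (mem_univ t) htx (h.hasDerivAt x)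
    rw [slope_def_field, le_div_iff₀ (by linarith)] at this
    linarith

end IsLogPotential

end

/-! ### The second derivative of the Legendre transform. -/

section
open Filter Topology

namespace IsDistribSecondDeriv

/-- The test functions 1 - (1 - f)ⁿ increase to the indicator of (p, q), so u alone determines the
mass of the interval. -/
theorem tendsto_integral_Ioo {u : ℝ → ℝ} {ν : Measure ℝ} (h : IsDistribSecondDeriv u ν) {p q : ℝ}
    (hp : 0 < p) (hq : q < 1) {f : ℝ → ℝ} (hf : ContDiff ℝ ∞ f)
    (hs : Function.support f = Ioo p q) (h01 : ∀ x, f x ∈ Icc (0 : ℝ) 1) :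
    Tendsto (fun n : ℕ => ∫ y, u y * deriv (deriv fun x => 1 - (1 - f x) ^ n) y) atTop
      (𝓝 (ν.real (Ioo p q))) := by
  have hK : Icc p q ⊆ Ioo 0 1 := fun x hx => ⟨hp.trans_le hx.1, hx.2.trans_lt hq⟩
  have hfin := h.finite _ isCompact_Icc hK
  have hsub : ∀ n : ℕ, Function.support (fun x => 1 - (1 - f x) ^ n) ⊆ Icc p q := by
    intro n x hx
    by_contra hx'
    have : f x = 0 := by
      by_contra h0
      have : x ∈ Function.support f := h0
      rw [hs] at this
      exact hx' (Ioo_subset_Icc_self this)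
    exact hx (by simp [this])
  have hts : ∀ n : ℕ, tsupport (fun x => 1 - (1 - f x) ^ n) ⊆ Icc p q := fun n =>
    closure_minimal (hsub n) isClosed_Icc
  have hsm : ∀ n : ℕ, ContDiff ℝ ∞ (fun x => 1 - (1 - f x) ^ n) := fun n =>
    contDiff_const.sub ((contDiff_const.sub hf).pow n)
  have e : ∀ n : ℕ, ∫ y, u y * deriv (deriv fun x => 1 - (1 - f x) ^ n) y =
      ∫ y, (1 - (1 - f y) ^ n) ∂ν := fun n =>
    h.weak _ (hsm n) (isCompact_Icc.of_isClosed_subset (isClosed_tsupport _) (hts n))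
      ((hts n).trans hK)
  simp only [e]
  rw [← integral_indicator_one measurableSet_Ioo]
  refine tendsto_integral_of_dominated_convergence ((Icc p q).indicator 1)
    (fun n => (hsm n).continuous.aestronglyMeasurable) ?_ ?_ ?_
  · exact (integrable_indicator_iff measurableSet_Icc).2 (integrableOn_const hfin.ne)
  · refine fun n => Eventually.of_forall fun x => ?_
    by_cases hx : x ∈ Icc p q
    · rw [indicator_of_mem hx]
      have h1 : 0 ≤ (1 - f x) ^ n := pow_nonneg (sub_nonneg.2 (h01 x).2) n
      have h2 : (1 - f x) ^ n ≤ 1 := pow_le_one₀ (sub_nonneg.2 (h01 x).2) (by linarith [(h01 x).1])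
      rw [Real.norm_of_nonneg (by linarith), Pi.one_apply]
      linarith
    · have : 1 - (1 - f x) ^ n = 0 := by
        by_contra h0
        exact hx (hsub n h0)
      rw [this, norm_zero, indicator_of_notMem hx]
  · refine Eventually.of_forall fun x => ?_
    by_cases hx : x ∈ Ioo p q
    · rw [indicator_of_mem hx, Pi.one_apply]
      have hne : f x ≠ 0 := by rwa [← hs] at hx
      have hpos : 0 < f x := lt_of_le_of_ne (h01 x).1 hne.symm
      have := tendsto_pow_atTop_nhds_zero_of_lt_one (sub_nonneg.2 (h01 x).2)
        (by linarith : 1 - f x < 1)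
      simpa using this.const_sub 1
    · rw [indicator_of_notMem hx]
      have : f x = 0 := by
        by_contra h0
        have : x ∈ Function.support f := h0
        rw [hs] at this
        exact hx this
      simp [this]

theorem measure_Ioo_eq {u : ℝ → ℝ} {ν ν' : Measure ℝ} (h : IsDistribSecondDeriv u ν)
    (h' : IsDistribSecondDeriv u ν') {p q : ℝ} (hp : 0 < p) (hq : q < 1) :
    ν (Ioo p q) = ν' (Ioo p q) := by
  obtain ⟨f, hs, hf, hr⟩ := (isOpen_Ioo (a := p) (b := q)).exists_contDiff_support_eq (n := ⊤)
  have h01 : ∀ x, f x ∈ Icc (0 : ℝ) 1 := fun x => hr (mem_range_self x)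
  have := tendsto_nhds_unique (h.tendsto_integral_Ioo hp hq hf hs h01)
    (h'.tendsto_integral_Ioo hp hq hf hs h01)
  have hK : Icc p q ⊆ Ioo 0 1 := fun x hx => ⟨hp.trans_le hx.1, hx.2.trans_lt hq⟩
  have f1 := (measure_mono (Ioo_subset_Icc_self (a := p) (b := q))).trans_lt
    (h.finite _ isCompact_Icc hK)
  have f2 := (measure_mono (Ioo_subset_Icc_self (a := p) (b := q))).trans_lt
    (h'.finite _ isCompact_Icc hK)
  exact (ENNReal.toReal_eq_toReal_iff' f1.ne f2.ne).1 this

/-- Exhaust (0,1) by intervals on which both measures are finite; there, rational open intervals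
determine them. Neither has mass outside (0,1). -/
theorem unique {u : ℝ → ℝ} {ν ν' : Measure ℝ} (h : IsDistribSecondDeriv u ν)
    (h' : IsDistribSecondDeriv u ν') : ν = ν' := by
  let s : ℕ → Set ℝ := fun n => Ioo (1 / (n + 2 : ℝ)) (1 - 1 / (n + 2 : ℝ))
  have hpos : ∀ n : ℕ, 0 < 1 / (n + 2 : ℝ) := fun n => by positivity
  have hs : ⋃ n, s n = Ioo 0 1 := by
    refine Subset.antisymm (iUnion_subset fun n x hx => ?_) fun x hx => ?_
    · have := hpos n
      exact ⟨by linarith [hx.1], by linarith [hx.2]⟩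
    · obtain ⟨n, hn⟩ := exists_nat_one_div_lt (lt_min hx.1 (sub_pos.2 hx.2))
      have h2 : 1 / (n + 2 : ℝ) ≤ 1 / (n + 1 : ℝ) := by gcongr; norm_num
      have h3 := hn.trans_le (min_le_left _ _)
      have h4 := hn.trans_le (min_le_right _ _)
      exact mem_iUnion.2 ⟨n, ⟨by linarith, by linarith⟩⟩
  have key : ∀ n, ν.restrict (s n) = ν'.restrict (s n) := by
    intro n
    have hK : Icc (1 / (n + 2 : ℝ)) (1 - 1 / (n + 2 : ℝ)) ⊆ Ioo 0 1 := fun x hx => by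
      have := hpos n
      exact ⟨by linarith [hx.1], by linarith [hx.2]⟩
    have : IsFiniteMeasure (ν.restrict (s n)) := ⟨by
      rw [Measure.restrict_apply_univ]
      exact (measure_mono Ioo_subset_Icc_self).trans_lt (h.finite _ isCompact_Icc hK)⟩
    refine Real.measure_ext_Ioo_rat fun a b => ?_
    rw [Measure.restrict_apply measurableSet_Ioo, Measure.restrict_apply measurableSet_Ioo,
      Ioo_inter_Ioo]
    refine h.measure_Ioo_eq h' (lt_of_lt_of_le (hpos n) le_sup_right)
      (lt_of_le_of_lt inf_le_right ?_)
    linarith [hpos n]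
  have := Measure.restrict_iUnion_congr.2 key
  rw [hs] at this
  rwa [Measure.restrict_eq_self_of_ae_mem (measure_eq_zero_iff_ae_notMem.1 h.outside |>.mono
      fun x hx => not_not.1 hx),
    Measure.restrict_eq_self_of_ae_mem (measure_eq_zero_iff_ae_notMem.1 h'.outside |>.mono
      fun x hx => not_not.1 hx)] at this

theorem distribSecondDeriv_eq {u : ℝ → ℝ} {ν : Measure ℝ} (h : IsDistribSecondDeriv u ν) :
    distribSecondDeriv u = ν := by
  have he : ∃ ν, IsDistribSecondDeriv u ν := ⟨ν, h⟩
  rw [distribSecondDeriv, dif_pos he]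
  exact he.choose_spec.unique h

end IsDistribSecondDeriv

/-- The probability measure with density `H`. -/
noncomputable def densityMeasure (H : ℝ → ℝ) : Measure ℝ :=
  volume.withDensity fun x => ENNReal.ofReal (H x)

/-- The quantile function of `F` on `(0,1)`, extended by zero. -/
noncomputable def quantile (F : ℝ → ℝ) (y : ℝ) : ℝ := (Ioo (0 : ℝ) 1).indicator
  (fun y => sInf {x | y ≤ F x}) y

/-- The push-forward under `F` of the Lebesgue measure on `{0 < F < 1}`. -/
noncomputable def momentPushforward (F : ℝ → ℝ) : Measure ℝ :=
  (volume.restrict (F ⁻¹' Ioo 0 1)).map F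

namespace IsLogPotential

variable {φ H : ℝ → ℝ} {C a b : ℝ}

theorem exists_moment_lt (h : IsLogPotential φ H C a b) {y : ℝ} (hy : 0 < y) :
    ∃ x, moment H x < y :=
  (h.density.tendsto_moment_atBot.eventually (gt_mem_nhds hy)).exists

theorem exists_lt_moment (h : IsLogPotential φ H C a b) {y : ℝ} (hy : y < 1) :
    ∃ x, y < moment H x :=
  (h.tendsto_moment_atTop.eventually (lt_mem_nhds hy)).exists

theorem exists_moment_eq (h : IsLogPotential φ H C a b) {y : ℝ} (hy : y ∈ Ioo (0 : ℝ) 1) :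
    ∃ x, moment H x = y := by
  obtain ⟨x₁, h₁⟩ := h.exists_moment_lt hy.1
  obtain ⟨x₂, h₂⟩ := h.exists_lt_moment hy.2
  exact mem_range_of_exists_le_of_exists_ge h.density.continuous_moment ⟨x₁, h₁.le⟩ ⟨x₂, h₂.le⟩

theorem densityMeasure_Iic (h : IsLogPotential φ H C a b) (x : ℝ) :
    densityMeasure H (Iic x) = ENNReal.ofReal (moment H x) := by
  rw [densityMeasure, withDensity_apply _ measurableSet_Iic, moment,
    ofReal_integral_eq_lintegral_ofReal h.density.integrable.integrableOn
      (Eventually.of_forall h.density.nonneg)]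

theorem densityMeasure_univ (h : IsLogPotential φ H C a b) : densityMeasure H univ = 1 := by
  rw [densityMeasure, withDensity_apply _ MeasurableSet.univ, Measure.restrict_univ,
    ← ofReal_integral_eq_lintegral_ofReal h.density.integrable
      (Eventually.of_forall h.density.nonneg), h.integral_eq_one, ENNReal.ofReal_one]

/-- The moment map pushes the curvature measure forward to the Lebesgue measure on `(0,1)`. -/
theorem map_moment (h : IsLogPotential φ H C a b) :
    (densityMeasure H).map (moment H) = volume.restrict (Ioo 0 1) := by
  have hm := h.density.continuous_moment.measurable
  have : IsFiniteMeasure ((densityMeasure H).map (moment H)) := ⟨by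
    rw [Measure.map_apply hm MeasurableSet.univ, preimage_univ, h.densityMeasure_univ]
    exact ENNReal.one_lt_top⟩
  refine Measure.ext_of_Iic _ _ fun y => ?_
  rw [Measure.map_apply hm measurableSet_Iic, Measure.restrict_apply measurableSet_Iic]
  rcases lt_or_ge y 0 with hy0 | hy0
  · have e1 : moment H ⁻¹' Iic y = ∅ := by
      ext x
      simpa using hy0.trans_le (h.density.moment_nonneg x)
    have e2 : Iic y ∩ Ioo 0 1 = ∅ := by
      ext x
      simp only [mem_inter_iff, mem_Iic, mem_Ioo, mem_empty_iff_false, iff_false]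
      rintro ⟨h1, h2, -⟩
      linarith
    rw [e1, e2, measure_empty, measure_empty]
  rcases le_or_gt 1 y with hy1 | hy1
  · have e1 : moment H ⁻¹' Iic y = univ := by
      ext x
      simpa using (h.moment_le_one x).trans hy1
    have e2 : Iic y ∩ Ioo 0 1 = Ioo 0 1 := inter_eq_right.2 fun x hx => hx.2.le.trans hy1
    rw [e1, e2, h.densityMeasure_univ, Real.volume_Ioo, sub_zero, ENNReal.ofReal_one]
  have e2 : Iic y ∩ Ioo 0 1 = Ioc 0 y := by
    ext x
    simp only [mem_inter_iff, mem_Iic, mem_Ioo, mem_Ioc]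
    constructor
    · rintro ⟨h1, h2, -⟩
      exact ⟨h2, h1⟩
    · rintro ⟨h1, h2⟩
      exact ⟨h2, h1, by linarith⟩
  rw [e2, Real.volume_Ioc, sub_zero]
  refine le_antisymm ?_ ?_
  · refine ENNReal.le_of_forall_pos_le_add fun ε hε _ => ?_
    have hε' : (0 : ℝ) < ε := hε
    obtain ⟨x, hx⟩ := h.exists_moment_eq (y := min (y + ε) ((y + 1) / 2))
      ⟨lt_min (by linarith) (by linarith), (min_le_right _ _).trans_lt (by linarith)⟩
    have hlt : y < moment H x := hx ▸ lt_min (by linarith) (by linarith)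
    calc densityMeasure H (moment H ⁻¹' Iic y) ≤ densityMeasure H (Iic x) := by
          refine measure_mono fun t ht => ?_
          by_contra hcon
          have := h.density.monotone_moment (not_le.1 hcon).le
          exact absurd (this.trans ht) (not_le.2 hlt)
      _ = ENNReal.ofReal (moment H x) := h.densityMeasure_Iic x
      _ ≤ ENNReal.ofReal (y + ε) := ENNReal.ofReal_le_ofReal (hx ▸ min_le_left _ _)
      _ = ENNReal.ofReal y + ε := by
          rw [ENNReal.ofReal_add hy0 hε'.le, ENNReal.ofReal_coe_nnreal]
  · rcases hy0.eq_or_lt with rfl | hy0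
    · simp
    obtain ⟨x, hx⟩ := h.exists_moment_eq ⟨hy0, hy1⟩
    rw [← hx, ← h.densityMeasure_Iic]
    exact measure_mono fun t ht => h.density.monotone_moment ht

theorem measurable_ofReal (h : IsLogPotential φ H C a b) :
    Measurable fun x => ENNReal.ofReal (H x) := h.density.measurable.ennreal_ofReal

theorem integral_Ioo_eq (h : IsLogPotential φ H C a b) {g : ℝ → ℝ}
    (hg : AEStronglyMeasurable g (volume.restrict (Ioo 0 1))) :
    ∫ y in Ioo 0 1, g y = ∫ x, H x * g (moment H x) := by
  rw [← h.map_moment] at hg ⊢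
  rw [integral_map h.density.continuous_moment.measurable.aemeasurable hg, densityMeasure,
    integral_withDensity_eq_integral_toReal_smul h.measurable_ofReal (by simp)]
  simp only [ENNReal.toReal_ofReal (h.density.nonneg _), smul_eq_mul]

theorem integrableOn_Ioo_iff (h : IsLogPotential φ H C a b) {g : ℝ → ℝ}
    (hg : AEStronglyMeasurable g (volume.restrict (Ioo 0 1))) :
    IntegrableOn g (Ioo 0 1) ↔ Integrable fun x => H x * g (moment H x) := by
  rw [IntegrableOn]
  rw [← h.map_moment] at hg ⊢
  rw [integrable_map_measure hg h.density.continuous_moment.measurable.aemeasurable,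
    densityMeasure, integrable_withDensity_iff_integrable_smul' h.measurable_ofReal (by simp)]
  simp only [ENNReal.toReal_ofReal (h.density.nonneg _), smul_eq_mul, Function.comp_apply]

theorem lintegral_Ioo_eq (h : IsLogPotential φ H C a b) {g : ℝ → ENNReal} (hg : Measurable g) :
    ∫⁻ y in Ioo 0 1, g y = ∫⁻ x, ENNReal.ofReal (H x) * g (moment H x) := by
  have hm := h.density.continuous_moment.measurable
  rw [← h.map_moment, lintegral_map hg hm, densityMeasure,
    lintegral_withDensity_eq_lintegral_mul _ h.measurable_ofReal
      (show Measurable fun x => g (moment H x) from hg.comp hm)]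
  rfl

/-- The set {x | y ≤ F x} is a closed half-line, so its infimum belongs to it. This equivalence
yields both the measurability of the quantile and its being a right inverse of F. -/
theorem quantile_le_iff (h : IsLogPotential φ H C a b) {y x : ℝ} (hy : y ∈ Ioo (0 : ℝ) 1) :
    quantile (moment H) y ≤ x ↔ y ≤ moment H x := by
  obtain ⟨x₁, h₁⟩ := h.exists_moment_lt hy.1
  obtain ⟨x₂, h₂⟩ := h.exists_lt_moment hy.2
  have hb : BddBelow {x | y ≤ moment H x} := ⟨x₁, fun t ht => by
    by_contra hcon
    have := h.density.monotone_moment (not_le.1 hcon).le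
    exact absurd (ht.trans this) (not_le.2 h₁)⟩
  have hcl : IsClosed {x | y ≤ moment H x} :=
    isClosed_le continuous_const h.density.continuous_moment
  rw [quantile, indicator_of_mem hy]
  constructor
  · intro hx
    have h3 : y ≤ moment H (sInf {x | y ≤ moment H x}) := hcl.csInf_mem ⟨x₂, h₂.le⟩ hb
    exact h3.trans (h.density.monotone_moment hx)
  · exact fun hx => csInf_le hb hx

theorem moment_quantile (h : IsLogPotential φ H C a b) {y : ℝ} (hy : y ∈ Ioo (0 : ℝ) 1) :
    moment H (quantile (moment H) y) = y := by
  refine le_antisymm ?_ ((h.quantile_le_iff hy).1 le_rfl)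
  obtain ⟨x, hx⟩ := h.exists_moment_eq hy
  rw [← hx]
  exact h.density.monotone_moment (by rw [hx, h.quantile_le_iff hy, hx])

theorem measurable_quantile (h : IsLogPotential φ H C a b) :
    Measurable (quantile (moment H)) := by
  refine measurable_of_Iic fun x => ?_
  have : quantile (moment H) ⁻¹' Iic x =
      (Ioo 0 1 ∩ Iic (moment H x)) ∪ ((Ioo 0 1)ᶜ ∩ {_y | (0 : ℝ) ≤ x}) := by
    ext y
    by_cases hy : y ∈ Ioo (0 : ℝ) 1
    · simp only [mem_preimage, mem_Iic, h.quantile_le_iff hy, mem_union, mem_inter_iff, hy,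
        true_and, mem_compl_iff, not_true, false_and, or_false]
    · simp only [mem_preimage, mem_Iic, quantile, indicator_of_notMem hy, mem_union,
        mem_inter_iff, hy, false_and, mem_compl_iff, not_false_eq_true, true_and, false_or,
        mem_ofPred_eq]
  rw [this]
  exact (measurableSet_Ioo.inter measurableSet_Iic).union
    (measurableSet_Ioo.compl.inter (MeasurableSet.const _))

/-- The levels over which the moment map is not injective. -/
def flatLevels (F : ℝ → ℝ) : Set ℝ := {y | 0 < volume {x | F x = y}}

/-- Distinct level sets are disjoint, and only countably many disjoint sets can have positive
measure. -/
theorem countable_flatLevels (h : IsLogPotential φ H C a b) :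
    (flatLevels (moment H)).Countable :=
  Measure.countable_meas_level_set_pos h.density.continuous_moment.measurable

/-- F is constant between the quantile of F(x) and x. If these two points differed, the level F(x)
would be flat. -/
theorem quantile_moment (h : IsLogPotential φ H C a b) {x : ℝ}
    (hx : moment H x ∈ Ioo (0 : ℝ) 1) (hx' : moment H x ∉ flatLevels (moment H)) :
    quantile (moment H) (moment H x) = x := by
  have hle : quantile (moment H) (moment H x) ≤ x := (h.quantile_le_iff hx).2 le_rfl
  refine le_antisymm hle (le_of_not_gt fun hlt => hx' ?_)
  have hsub : Icc (quantile (moment H) (moment H x)) x ⊆ {t | moment H t = moment H x} := by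
    intro t ht
    refine le_antisymm (h.density.monotone_moment ht.2) ?_
    conv_lhs => rw [← h.moment_quantile hx]
    exact h.density.monotone_moment ht.1
  refine lt_of_lt_of_le ?_ (measure_mono hsub)
  simpa [Real.volume_Icc] using hlt

/-- The levels `y`, of full measure in `(0,1)`, over which the moment map is injective with
positive derivative. -/
def regularLevels (H : ℝ → ℝ) : Set ℝ :=
  (Ioo 0 1 ∩ {y | 0 < H (quantile (moment H) y)}) \ flatLevels (moment H)

theorem measurableSet_regularLevels (h : IsLogPotential φ H C a b) :
    MeasurableSet (regularLevels H) :=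
  (measurableSet_Ioo.inter (measurableSet_lt measurable_const
    (h.density.measurable.comp h.measurable_quantile))).diff h.countable_flatLevels.measurableSet

/-- Flat levels are countable. The non-flat levels whose quantile is a zero of H have measure ∫ H
over a set where H = 0, by transport along F. -/
theorem ae_mem_regularLevels (h : IsLogPotential φ H C a b) :
    ∀ᵐ y ∂volume.restrict (Ioo (0 : ℝ) 1), y ∈ regularLevels H := by
  let S := Ioo (0 : ℝ) 1 ∩ ({y | H (quantile (moment H) y) ≤ 0} \ flatLevels (moment H))
  have hSm : MeasurableSet S := measurableSet_Ioo.inter ((measurableSet_le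
    (h.density.measurable.comp h.measurable_quantile) measurable_const).diff
    h.countable_flatLevels.measurableSet)
  have h0 : (volume.restrict (Ioo (0 : ℝ) 1)) S = 0 := by
    rw [← lintegral_indicator_one hSm, h.lintegral_Ioo_eq (measurable_one.indicator hSm)]
    refine (lintegral_congr fun x => ?_).trans lintegral_zero
    by_cases hx : moment H x ∈ S
    · have hx2 := hx.2.1
      rw [mem_ofPred_eq, h.quantile_moment hx.1 hx.2.2] at hx2
      rw [ENNReal.ofReal_of_nonpos hx2, zero_mul]
    · rw [indicator_of_notMem hx, mul_zero]
  have h1 : (volume.restrict (Ioo (0 : ℝ) 1)) (flatLevels (moment H)) = 0 :=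
    h.countable_flatLevels.measure_zero _
  filter_upwards [measure_eq_zero_iff_ae_notMem.1 h0, measure_eq_zero_iff_ae_notMem.1 h1,
    ae_restrict_mem measurableSet_Ioo] with y hy1 hy2 hy3
  refine ⟨⟨hy3, ?_⟩, hy2⟩
  by_contra hcon
  exact hy1 ⟨hy3, not_lt.1 (show ¬ 0 < H (quantile (moment H) y) from hcon), hy2⟩

theorem momentPushforward_apply (h : IsLogPotential φ H C a b) {E : Set ℝ} (hE : MeasurableSet E) :
    momentPushforward (moment H) E = volume (moment H ⁻¹' (E ∩ Ioo 0 1)) := by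
  have hm := h.density.continuous_moment.measurable
  rw [momentPushforward, Measure.map_apply hm hE, Measure.restrict_apply (hm hE), preimage_inter]

/-- The change of variables dx = dy / H: transport along F sends the density 1/H(quantile y) to H ·
H⁻¹ = 1. -/
theorem momentPushforward_restrict_regularLevels (h : IsLogPotential φ H C a b) :
    (momentPushforward (moment H)).restrict (regularLevels H) =
      volume.withDensity ((regularLevels H).indicator
        fun y => ENNReal.ofReal (H (quantile (moment H) y))⁻¹) := by
  have hD := h.measurableSet_regularLevels
  have hq : Measurable fun y => ENNReal.ofReal (H (quantile (moment H) y))⁻¹ :=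
    (h.density.measurable.comp h.measurable_quantile).inv.ennreal_ofReal
  have hm := h.density.continuous_moment.measurable
  have hD01 : regularLevels H ⊆ Ioo 0 1 := fun y hy => hy.1.1
  ext E hE
  rw [Measure.restrict_apply hE, h.momentPushforward_apply (hE.inter hD),
    withDensity_apply _ hE, setLIntegral_indicator hD, inter_comm (regularLevels H) E,
    inter_eq_left.2 (inter_subset_right.trans hD01)]
  have e : ∫⁻ y in E ∩ regularLevels H, ENNReal.ofReal (H (quantile (moment H) y))⁻¹ =
      ∫⁻ y in Ioo 0 1, (E ∩ regularLevels H).indicator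
        (fun y => ENNReal.ofReal (H (quantile (moment H) y))⁻¹) y := by
    rw [setLIntegral_indicator (hE.inter hD), inter_eq_left.2 (inter_subset_right.trans hD01)]
  rw [e, h.lintegral_Ioo_eq (hq.indicator (hE.inter hD)),
    ← lintegral_indicator_one (hm (hE.inter hD))]
  refine lintegral_congr fun x => ?_
  by_cases hx : moment H x ∈ E ∩ regularLevels H
  · have hqx := h.quantile_moment hx.2.1.1 hx.2.2
    have hpos := hx.2.1.2
    rw [mem_ofPred_eq, hqx] at hpos
    rw [indicator_of_mem hx, indicator_of_mem (by exact hx), hqx, ← ENNReal.ofReal_mul hpos.le,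
      mul_inv_cancel₀ hpos.ne', ENNReal.ofReal_one, Pi.one_apply]
  · rw [indicator_of_notMem hx, indicator_of_notMem (by exact hx), mul_zero]

/-- The rest of the push-forward is carried by a null set of levels (for instance, atoms over
intervals where φ' is constant), so uniqueness of the Lebesgue decomposition identifies the density.
-/
theorem ae_rnDeriv_momentPushforward (h : IsLogPotential φ H C a b) :
    ∀ᵐ y ∂volume.restrict (Ioo (0 : ℝ) 1), y ∈ regularLevels H ∧
      ((momentPushforward (moment H)).rnDeriv volume y).toReal =
        (H (quantile (moment H) y))⁻¹ := by
  have hD := h.measurableSet_regularLevels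
  have hq : Measurable fun y => ENNReal.ofReal (H (quantile (moment H) y))⁻¹ :=
    (h.density.measurable.comp h.measurable_quantile).inv.ennreal_ofReal
  have hsing : (momentPushforward (moment H)).restrict (regularLevels H)ᶜ ⟂ₘ volume := by
    refine ⟨regularLevels H ∪ (Ioo 0 1)ᶜ, hD.union measurableSet_Ioo.compl, ?_, ?_⟩
    · rw [Measure.restrict_apply (hD.union measurableSet_Ioo.compl), union_inter_distrib_right,
        inter_compl_self, empty_union]
      refine measure_mono_null inter_subset_left ?_
      rw [h.momentPushforward_apply measurableSet_Ioo.compl, compl_inter_self, preimage_empty,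
        measure_empty]
    · have := ae_iff.1 h.ae_mem_regularLevels
      rw [Measure.restrict_apply' measurableSet_Ioo] at this
      rw [compl_union, compl_compl]
      exact this
  have hdec : momentPushforward (moment H) =
      (momentPushforward (moment H)).restrict (regularLevels H)ᶜ +
        volume.withDensity ((regularLevels H).indicator
          fun y => ENNReal.ofReal (H (quantile (moment H) y))⁻¹) := by
    rw [← h.momentPushforward_restrict_regularLevels, Measure.restrict_compl_add_restrict hD]
  have := Measure.eq_rnDeriv (hq.indicator hD) hsing hdec
  filter_upwards [ae_restrict_of_ae this, h.ae_mem_regularLevels] with y hy hy'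
  refine ⟨hy', ?_⟩
  rw [← hy, indicator_of_mem hy', ENNReal.toReal_ofReal (inv_nonneg.2 (h.density.nonneg _))]

theorem hasCompactSupport_comp_moment (h : IsLogPotential φ H C a b) {χ : ℝ → ℝ}
    (hc : HasCompactSupport χ) (hs : tsupport χ ⊆ Ioo 0 1) :
    HasCompactSupport fun x => χ (moment H x) := by
  rcases (tsupport χ).eq_empty_or_nonempty with he | hne
  · have : χ = 0 := tsupport_eq_empty_iff.1 he
    rw [this]
    exact HasCompactSupport.zero
  obtain ⟨p, hp, hpm⟩ := hc.isCompact.exists_isLeast hne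
  obtain ⟨q, hq, hqm⟩ := hc.isCompact.exists_isGreatest hne
  obtain ⟨x₁, h₁⟩ := h.exists_moment_lt (hs hp).1
  obtain ⟨x₂, h₂⟩ := h.exists_lt_moment (hs hq).2
  refine HasCompactSupport.intro (isCompact_Icc (a := x₁) (b := x₂)) fun x hx => ?_
  by_contra hne
  have hmem := subset_tsupport χ hne
  refine hx ⟨le_of_not_gt fun hlt => ?_, le_of_not_gt fun hlt => ?_⟩
  · linarith [h.density.monotone_moment hlt.le, hpm hmem]
  · linarith [h.density.monotone_moment hlt.le, hqm hmem]

/-- On (0,1) the supremum is attained at the quantile, a measurable function of y. -/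
theorem aestronglyMeasurable_legendre (h : IsLogPotential φ H C a b) :
    AEStronglyMeasurable (legendre φ) (volume.restrict (Ioo 0 1)) := by
  have hm := h.measurable_quantile
  have hφ := h.continuous.measurable
  have hg : Measurable fun y => quantile (moment H) y * y - φ (quantile (moment H) y) := by
    fun_prop
  refine hg.aestronglyMeasurable.congr ?_
  filter_upwards [ae_restrict_mem measurableSet_Ioo] with y hy
  have := h.legendre_moment (quantile (moment H) y)
  rw [h.moment_quantile hy] at this
  exact this.symm

/-- The second distributional derivative of the Legendre transform. -/
theorem isDistribSecondDeriv_legendre (h : IsLogPotential φ H C a b) :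
    IsDistribSecondDeriv (legendre φ) (momentPushforward (moment H)) where
  outside := by
    rw [h.momentPushforward_apply measurableSet_Ioo.compl, compl_inter_self, preimage_empty,
      measure_empty]
  finite K hK hs := by
    rw [h.momentPushforward_apply hK.measurableSet, inter_eq_left.2 hs]
    rcases K.eq_empty_or_nonempty with rfl | hne
    · simp
    obtain ⟨p, hp, hpm⟩ := hK.exists_isLeast hne
    obtain ⟨q, hq, hqm⟩ := hK.exists_isGreatest hne
    obtain ⟨x₁, h₁⟩ := h.exists_moment_lt (hs hp).1
    obtain ⟨x₂, h₂⟩ := h.exists_lt_moment (hs hq).2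
    refine (measure_mono (t := Icc x₁ x₂) fun x hx => ⟨le_of_not_gt fun hlt => ?_,
      le_of_not_gt fun hlt => ?_⟩).trans_lt isCompact_Icc.measure_lt_top
    · linarith [h.density.monotone_moment hlt.le, hpm hx]
    · linarith [h.density.monotone_moment hlt.le, hqm hx]
  weak χ hχ hc hs := by
    have hm := h.density.continuous_moment
    have hχ' := (contDiff_infty_iff_deriv.1 hχ).2
    have hχ'' := (contDiff_infty_iff_deriv.1 hχ').2
    have hs' : tsupport (deriv χ) ⊆ Ioo 0 1 := (tsupport_deriv_subset).trans hs
    have hs'' : tsupport (deriv (deriv χ)) ⊆ Ioo 0 1 := (tsupport_deriv_subset).trans hs'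
    have c0 := h.hasCompactSupport_comp_moment hc hs
    have c1 := h.hasCompactSupport_comp_moment hc.deriv hs'
    have c2 := h.hasCompactSupport_comp_moment hc.deriv.deriv hs''
    have hzero : ∀ {f : ℝ → ℝ}, tsupport f ⊆ Ioo 0 1 → ∀ y, y ∉ Ioo (0 : ℝ) 1 → f y = 0 :=
      fun hf y hy => image_eq_zero_of_notMem_tsupport fun hmem => hy (hf hmem)
    -- Substitute y = F(x) on the left. With u(F) = xF - φ, whose derivative is xH almost
    -- everywhere, the claim becomes ∫ T' = 0 for the compactly supported T = u(F) χ'(F) - x χ(F).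
    have e1 : ∫ y, legendre φ y * deriv (deriv χ) y =
        ∫ x, (x * moment H x - φ x) * deriv (deriv χ) (moment H x) * H x := by
      rw [← setIntegral_eq_integral_of_forall_compl_eq_zero (s := Ioo 0 1)
        (fun y hy => by rw [hzero hs'' y hy, mul_zero]),
        h.integral_Ioo_eq (g := fun y => legendre φ y * deriv (deriv χ) y)
          (h.aestronglyMeasurable_legendre.mul hχ''.continuous.aestronglyMeasurable)]
      congr 1
      ext x
      rw [h.legendre_moment]
      ring
    have e2 : ∫ y, χ y ∂(momentPushforward (moment H)) = ∫ x, χ (moment H x) := by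
      rw [momentPushforward, integral_map hm.measurable.aemeasurable
        hχ.continuous.aestronglyMeasurable]
      exact setIntegral_eq_integral_of_forall_compl_eq_zero fun x hx => hzero hs _ hx
    have i1 : Integrable fun x => (x * moment H x - φ x) * deriv (deriv χ) (moment H x) * H x := by
      refine h.density.integrable_continuous_mul ?_ c2.mul_left
      have := h.continuous
      have := hχ''.continuous
      fun_prop
    have i2 : Integrable fun x => χ (moment H x) :=
      (hχ.continuous.comp hm).integrable_of_hasCompactSupport c0
    have a0 : LocAC fun x => χ (moment H x) := by
      obtain ⟨K, hK⟩ := hχ.lipschitzWith_of_hasCompactSupport hc (by simp)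
      exact LocAC.of_lipschitzWith (hK.comp h.density.lipschitzWith_moment)
    have a1 : LocAC fun x => deriv χ (moment H x) := by
      obtain ⟨K, hK⟩ := hχ'.lipschitzWith_of_hasCompactSupport hc.deriv (by simp)
      exact LocAC.of_lipschitzWith (hK.comp h.density.lipschitzWith_moment)
    have a5 : LocAC fun x => x := LocAC.of_contDiff contDiff_id
    have hT : LocAC fun x => (x * moment H x - φ x) * deriv χ (moment H x) - x * χ (moment H x) :=
      (((a5.mul h.density.locAC_moment).sub h.locAC).mul a1).sub (a5.mul a0)
    have hd : ∀ᵐ x, HasDerivAt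
        (fun x => (x * moment H x - φ x) * deriv χ (moment H x) - x * χ (moment H x))
        ((x * moment H x - φ x) * deriv (deriv χ) (moment H x) * H x - χ (moment H x)) x := by
      filter_upwards [h.density.ae_hasDerivAt_moment] with x d2
      have d5 := hasDerivAt_id' x
      have d0 : HasDerivAt (fun x => χ (moment H x)) (deriv χ (moment H x) * H x) x :=
        (hχ.differentiable (by simp) _).hasDerivAt.comp x d2
      have d1 : HasDerivAt (fun x => deriv χ (moment H x)) (deriv (deriv χ) (moment H x) * H x) x :=
        (hχ'.differentiable (by simp) _).hasDerivAt.comp x d2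
      exact ((((d5.fun_mul d2).fun_sub (h.hasDerivAt x)).fun_mul d1).fun_sub
        (d5.fun_mul d0)).congr_deriv (by ring)
    have hTc : HasCompactSupport
        fun x => (x * moment H x - φ x) * deriv χ (moment H x) - x * χ (moment H x) :=
      (c1.mul_left (f := fun x => x * moment H x - φ x)).sub (c0.mul_left (f := fun x => x))
    have := hT.integral_eq_sub hd (i1.sub i2) (tendsto_of_hasCompactSupport hTc).1
      (tendsto_of_hasCompactSupport hTc).2
    rw [integral_sub i1 i2, sub_self] at this
    rw [e1, e2]
    linarith

theorem ae_regSecondDeriv (h : IsLogPotential φ H C a b) :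
    ∀ᵐ y ∂volume.restrict (Ioo (0 : ℝ) 1), y ∈ regularLevels H ∧
      regSecondDeriv (legendre φ) y = (H (quantile (moment H) y))⁻¹ := by
  unfold regSecondDeriv
  rw [h.isDistribSecondDeriv_legendre.distribSecondDeriv_eq]
  exact h.ae_rnDeriv_momentPushforward

theorem ae_regSecondDeriv_pos (h : IsLogPotential φ H C a b) :
    ∀ᵐ y ∂volume.restrict (Ioo (0 : ℝ) 1), 0 < regSecondDeriv (legendre φ) y := by
  filter_upwards [h.ae_regSecondDeriv] with y hy
  rw [hy.2]
  exact inv_pos.2 hy.1.1.2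

theorem ae_log_regSecondDeriv (h : IsLogPotential φ H C a b) :
    (fun y => Real.log (regSecondDeriv (legendre φ) y)) =ᵐ[volume.restrict (Ioo (0 : ℝ) 1)]
      fun y => -Real.log (H (quantile (moment H) y)) := by
  filter_upwards [h.ae_regSecondDeriv] with y hy
  rw [hy.2, Real.log_inv]

/-- The quantile inverts F at almost every point for the measure H dx. Elsewhere, up to a Lebesgue
null set, H = 0 and both sides vanish. -/
theorem ae_mul_log_quantile_moment (h : IsLogPotential φ H C a b) :
    ∀ᵐ x, H x * -Real.log (H (quantile (moment H) (moment H x))) =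
      -(H x * Real.log (H x)) := by
  have h1 : ∀ᵐ x ∂densityMeasure H, moment H x ∈ regularLevels H := by
    have := h.ae_mem_regularLevels
    rw [← h.map_moment] at this
    exact ae_of_ae_map h.density.continuous_moment.measurable.aemeasurable this
  rw [densityMeasure, ae_withDensity_iff h.measurable_ofReal] at h1
  filter_upwards [h1] with x hx
  rcases (h.density.nonneg x).eq_or_lt with h0 | h0
  · rw [← h0]; simp
  · have := hx (by simpa using h0)
    rw [h.quantile_moment this.1.1 this.2]
    ring

theorem aestronglyMeasurable_log_quantile (h : IsLogPotential φ H C a b) :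
    AEStronglyMeasurable (fun y => -Real.log (H (quantile (moment H) y)))
      (volume.restrict (Ioo 0 1)) :=
  (Real.measurable_log.comp (h.density.measurable.comp
    h.measurable_quantile)).neg.aestronglyMeasurable

theorem integrableOn_log_regSecondDeriv (h : IsLogPotential φ H C a b) :
    IntegrableOn (fun y => Real.log (regSecondDeriv (legendre φ) y)) (Ioo 0 1) := by
  refine Integrable.congr ?_ h.ae_log_regSecondDeriv.symm
  exact (h.integrableOn_Ioo_iff h.aestronglyMeasurable_log_quantile).2
    (h.integrable_mul_log.neg.congr (h.ae_mul_log_quantile_moment.mono fun x hx => hx.symm))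

theorem integral_log_regSecondDeriv (h : IsLogPotential φ H C a b) :
    ∫ y in Ioo 0 1, Real.log (regSecondDeriv (legendre φ) y) = -∫ x, H x * Real.log (H x) := by
  rw [integral_congr_ae h.ae_log_regSecondDeriv,
    h.integral_Ioo_eq h.aestronglyMeasurable_log_quantile,
    integral_congr_ae h.ae_mul_log_quantile_moment, integral_neg]

theorem integrableOn_legendre (h : IsLogPotential φ H C a b) :
    IntegrableOn (legendre φ) (Ioo 0 1) := by
  rw [h.integrableOn_Ioo_iff h.aestronglyMeasurable_legendre]
  simp only [h.legendre_moment]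
  simpa only [mul_comm] using h.integrable_legendre

theorem integral_legendre (h : IsLogPotential φ H C a b) :
    ∫ y in Ioo 0 1, legendre φ y = ∫ x, (x * moment H x - φ x) * H x := by
  rw [h.integral_Ioo_eq h.aestronglyMeasurable_legendre]
  simp only [h.legendre_moment, mul_comm (H _)]

end IsLogPotential

end

/-! ### Assembly of the formula. -/

theorem lemma2p3 (Φ : O1Metric) (hΦ : Φ.MemH11) (hS : Φ.IsS1Invariant)
    (u : ℝ → ℝ) (hu : u = legendre Φ.logWeight) :
    Integrable Φ.entropyIntegrand ∧
    (∀ y ∈ Icc (0 : ℝ) 1, BddAbove (range fun x : ℝ => x * y - Φ.logWeight x)) ∧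
    IntervalIntegrable u volume 0 1 ∧
    IsDistribSecondDeriv u (distribSecondDeriv u) ∧
    (∀ᵐ y ∂volume.restrict (Icc (0 : ℝ) 1), 0 < regSecondDeriv u y) ∧
    IntervalIntegrable (fun y => Real.log (regSecondDeriv u y)) volume 0 1 ∧
    Φ.kEnergy =
      2 * ((1 / 2) * (u 0 + u 1) - ∫ y in (0 : ℝ)..1, u y)
        - (∫ y in (0 : ℝ)..1, Real.log (regSecondDeriv u y)) + 1 := by
  subst hu
  obtain ⟨H, C, hm, h0, hle, hw, hent, hK⟩ := O1Metric.exists_logDensity hΦ hS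
  have hd : IsLogDensity H C := ⟨hm, h0, hle⟩
  -- The constants a and b are the values of the two weights at their poles.
  have h : IsLogPotential Φ.logWeight H C (Φ.weightInf 0) (Φ.weight 0) :=
    ⟨hd, hd.hasDerivAt_of_weak Φ.continuous_logWeight Φ.tendsto_logWeight_atBot hw,
      Φ.tendsto_logWeight_atBot, Φ.tendsto_logWeight_sub_atTop⟩
  have hIoo : ∀ f : ℝ → ℝ, ∫ y in (0 : ℝ)..1, f y = ∫ y in Ioo 0 1, f y := fun f => by
    rw [intervalIntegral.integral_of_le zero_le_one, integral_Ioc_eq_integral_Ioo]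
  refine ⟨hent h.integrable_entropy, fun y hy => h.bddAbove_range hy, ?_, ?_, ?_, ?_, ?_⟩
  · exact (intervalIntegrable_iff_integrableOn_Ioo_of_le zero_le_one).2 h.integrableOn_legendre
  · rw [h.isDistribSecondDeriv_legendre.distribSecondDeriv_eq]
    exact h.isDistribSecondDeriv_legendre
  · rw [restrict_Ioo_eq_restrict_Icc.symm]
    exact h.ae_regSecondDeriv_pos
  · exact (intervalIntegrable_iff_integrableOn_Ioo_of_le zero_le_one).2
      h.integrableOn_log_regSecondDeriv
  · rw [hK, h.kEnergy_formula, hIoo, hIoo, h.integral_legendre, h.integral_log_regSecondDeriv,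
      h.legendre_zero, h.legendre_one]
    ring
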